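/- **Setting.** Work in $\widehat{\mathbb R}^3=\mathbb R^3\cup\{\infty\}$; "sphere" means oriented sphere, oriented plane or point. A *Dupin cyclide* (other than a circle) is given by an orthogonal decomposition $\mathbb R^{4,2}=P^{(1)}\oplus P^{(2)}$ of the space of Lie sphere coordinates into two subspaces of signature $(+,+,-)$, neither of whose families of spheres consists of points only. The isotropic lines of $P^{(i)}$ form a conic, i.e. a closed one-parameter family of spheres $s^{(i)}(t_i)$. Each $s^{(1)}(t_1)$ is in oriented contact with each $s^{(2)}(t_2)$; the contact point and the common oriented normal there give the curvature line parametrization of the cyclide, whose coordinate lines are circles or straight lines. As degenerate cyclides we also admit *spherical* ones: an oriented proper sphere or plane with two orthogonal pencils of circles, which up to a Möbius transformation are either the meridians (full circles) and parallels of a round sphere or two orthogonal families of parallel lines in a plane (each line completed by $\infty$); they are parametrized accordingly over $S^1\times S^1$. A *cyclidic patch* $f$ is the restriction of such a parametrization to a closed rectangle $[a_1,b_1]\times[a_2,b_2]$ with $a_i<b_i$ whose sides are proper arcs of the parameter circles. Its vertices are $x=f(a_1,a_2)$, $x_1=f(b_1,a_2)$, $x_{12}=f(b_1,b_2)$, $x_2=f(a_1,b_2)$,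 and $\widehat{x,x_1}=f([a_1,b_1]\times\{a_2\})$, $\widehat{x,x_2}=f(\{a_1\}\times[a_2,b_2])$ are the two boundary arcs at $x$. The *vertex frame* at a vertex is $(t^{(1)},t^{(2)},n)$, where $t^{(1)}$ and $t^{(2)}$ are the unit tangent vectors of the two boundary arcs at this vertex (in the first and the second coordinate direction), directed along the arcs to the neighbouring vertices, and $n$ is the oriented unit normal. A point is *singular* if a coordinate line collapses to it, equivalently if all curvature circles of one family pass through it. A *subpatch* of $f$ is the restriction of $f$ to a smaller closed rectangle. Points of $\widehat{\mathbb R}^3$ are *concircular* if they lie on a proper circle or on a straight line (completed by $\infty$). **Proposition.** Let $f$ be a cyclidic patch (possibly spherical), and let $\widetilde x_1\in\widehat{x,x_1}$ and $\widetilde x_2\in\widehat{x,x_2}$ be points different from $x$. 1. There is exactly one subpatch $\widetilde f$ of $f$ that has the vertex $x$, whose boundary arcs at $x$ are contained in the respective arcs $\widehat{x,x_1}$, $\widehat{x,x_2}$ and whose vertices adjacent to $x$ in the first and the second direction are $\widetilde x_1$ and $\widetilde x_2$. 2. Suppose that $\widetilde x_1,\widetilde x_2$ are non-singular and, if $f$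 is spherical, that $\widetilde x_1\neq\widetilde x_2$. Let $\widetilde x_{12}$ be the fourth vertex of $\widetilde f$. Then $x,\widetilde x_1,\widetilde x_{12},\widetilde x_2$ are four distinct concircular points. If they are all finite, the vertex frames of $\widetilde f$ are orthonormal, and for every pair $p,q$ of adjacent vertices, joined by a boundary arc of direction $i\in\{1,2\}$, with frames $B_p,B_q$ and with $\{i,j\}=\{1,2\}$, one has $$B_q=H(B_p)\quad\text{if } p,q \text{ are not separated on the circle by the two other vertices},$$ $$B_q=H(F^{(j)}(B_p))\quad\text{if they are separated.}$$ Here $H(v)=v-2\,\frac{\langle q-p,v\rangle}{\langle q-p,q-p\rangle}(q-p)$ is the reflection in the perpendicular bisecting plane of $[p,q]$ acting on vectors, and $F^{(j)}$ reverses the sign of $t^{(j)}$ in $(t^{(1)},t^{(2)},n)$. -/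

import Mathlib

noncomputable section

open scoped InnerProductSpace

/-- Euclidean three-space. -/
abbrev E3 : Type := EuclideanSpace ℝ (Fin 3)

/-- The space `ℝ^{4,2}` of homogeneous Lie coordinates, written in the basis
`(e₁, e₂, e₃, e₀, e_∞, e_r)`, where `e₀` and `e_∞` are isotropic with product `-1/2` and
`e_r` has square `-1`. A proper oriented sphere with centre `c` and oriented radius `r` (inward
normals for `r > 0`) is `(c, 1, ‖c‖² - r², r)`, a point `x` is `(x, 1, ‖x‖², 0)`, the point at
infinity is `(0, 0, 1, 0)` and an oriented plane `⟪n, ·⟫ = d` is `(n, 0, 2d, 1)`, all up to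
nonzero multiples. -/
abbrev LieSpace : Type := E3 × ℝ × ℝ × ℝ

namespace LieSpace

/-- Euclidean part. -/
def vec (y : LieSpace) : E3 := y.1
/-- Component along `e₀`. -/
def e0 (y : LieSpace) : ℝ := y.2.1
/-- Component along `e_∞`. -/
def eInf (y : LieSpace) : ℝ := y.2.2.1
/-- Component along `e_r`; it vanishes exactly on the point spheres. -/
def er (y : LieSpace) : ℝ := y.2.2.2

/-- The Lie product of signature `(4,2)`. Two oriented spheres are in oriented contact iff the
product of their (isotropic) coordinate vectors is zero. -/
def form (y z : LieSpace) : ℝ :=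
  ⟪y.vec, z.vec⟫_ℝ - (y.e0 * z.eInf + y.eInf * z.e0) / 2 - y.er * z.er

/-- The point sphere in the contact element spanned by two spheres in oriented contact
(in homogeneous coordinates). -/
def contactVec (y z : LieSpace) : LieSpace := z.er • y - y.er • z

/-- The point of `ℝ³ ∪ {∞}` with the given homogeneous coordinates. -/
def toPoint (y : LieSpace) : OnePoint E3 :=
  open Classical in if y.e0 = 0 then OnePoint.infty else ((y.e0⁻¹ • y.vec : E3) : OnePoint E3)

/-- The unit normal of the contact element spanned by two spheres in oriented contact, when its
point is finite: the element contains the oriented plane `(n, 0, 2d, 1)`. -/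
def contactNormal (y z : LieSpace) : E3 :=
  (y.e0 * z.er - z.e0 * y.er)⁻¹ • (y.e0 • z.vec - z.e0 • y.vec)

end LieSpace

/-- A Dupin cyclide (not a circle) with a curvature line parametrization: a polar decomposition of
`ℝ^{4,2}` into two subspaces `P i = span (frame i)` of signature `(+,+,-)`, each with an
orthonormal basis that serves to parametrize its conic of isotropic lines. -/
structure DupinCyclide where
  frame : Fin 2 → Fin 3 → LieSpace
  gram : ∀ i k j l, LieSpace.form (frame i k) (frame j l) =
    if i = j ∧ k = l then (if k = 2 then -1 else 1) else 0
  /-- Neither of the two families of spheres consists of points only. -/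
  not_circle : ∀ i, ∃ k, (frame i k).er ≠ 0

/-- The `i`-th family of enveloping oriented spheres (the conic `P i ∩ Lie quadric`), traversed
once when `t` runs through an interval of length `2π`. -/
def DupinCyclide.sphere (D : DupinCyclide) (i : Fin 2) (t : ℝ) : LieSpace :=
  Real.cos t • D.frame i 0 + Real.sin t • D.frame i 1 + D.frame i 2

/-- An oriented proper sphere or plane `s` of `ℝ³ ∪ {∞}`, with an orthonormal basis `w` of the
Minkowski space of signature `(3,1)` of point vectors in contact with `s`; the points of `s` are
the isotropic lines of that space. -/
structure FramedSphere where
  s : LieSpace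
  isotropic : LieSpace.form s s = 0
  not_point : s.er ≠ 0
  w : Fin 4 → LieSpace
  gram : ∀ k l, LieSpace.form (w k) (w l) = if k = l then (if k = 3 then -1 else 1) else 0
  incident : ∀ k, LieSpace.form s (w k) = 0
  points : ∀ k, (w k).er = 0

/-- Points of the sphere in the coordinates given by the circles through the two points
`w 3 ± w 2` (`θ` constant) and the circles orthogonal to these (`φ` constant): meridians and
parallels, up to a Möbius transformation. -/
def FramedSphere.geographic (S : FramedSphere) (φ θ : ℝ) : LieSpace :=
  Real.cos φ • (Real.cos θ • S.w 0 + Real.sin θ • S.w 1) + Real.sin φ • S.w 2 + S.w 3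

/-- Points of the sphere in the coordinates given by two orthogonal families of circles, each
family consisting of circles that are mutually tangent in the point `w 3 + w 2`: two orthogonal
families of parallel lines, up to a Möbius transformation. In terms of `X = tan (α / 2)` and
`Y = tan (β / 2)` this is
`(w 3 - w 2) / 2 + X w 0 + Y w 1 + (X² + Y²) (w 3 + w 2) / 2`, up to a factor. -/
def FramedSphere.cartesian (S : FramedSphere) (α β : ℝ) : LieSpace :=
  open Classical in
  if Real.cos α = -1 ∧ Real.cos β = -1 then S.w 3 + S.w 2
  else ((1 + Real.cos α) * (1 + Real.cos β) / 2) • (S.w 3 - S.w 2)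
    + (Real.sin α * (1 + Real.cos β)) • S.w 0
    + ((1 + Real.cos α) * Real.sin β) • S.w 1
    + (1 - Real.cos α * Real.cos β) • (S.w 3 + S.w 2)

/-- Surfaces supporting cyclidic patches, with coordinates along their curvature lines: Dupin
cyclides and, as their degenerate limits, spheres and planes with a pair of orthogonal pencils of
circles. Both parameters have period `2π`. -/
inductive CyclidicSurface where
  | dupin (D : DupinCyclide)
  | geographic (S : FramedSphere)
  | geographicSwap (S : FramedSphere)
  | cartesian (S : FramedSphere)

namespace CyclidicSurface

/-- Two spheres that span the contact element of the surface at the given parameters. -/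
def contact : CyclidicSurface → ℝ → ℝ → LieSpace × LieSpace
  | dupin D, t₁, t₂ => (D.sphere 0 t₁, D.sphere 1 t₂)
  | geographic S, t₁, t₂ => (S.s, S.geographic t₁ t₂)
  | geographicSwap S, t₁, t₂ => (S.s, S.geographic t₂ t₁)
  | cartesian S, t₁, t₂ => (S.s, S.cartesian t₁ t₂)

/-- The surface is a sphere or a plane. -/
def IsSpherical : CyclidicSurface → Prop
  | dupin _ => False
  | _ => True

/-- Homogeneous coordinates of the point of the surface. -/
def hat (C : CyclidicSurface) (t₁ t₂ : ℝ) : LieSpace :=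
  LieSpace.contactVec (C.contact t₁ t₂).1 (C.contact t₁ t₂).2

/-- The curvature line parametrization with values in `ℝ³ ∪ {∞}`. -/
def point (C : CyclidicSurface) (t₁ t₂ : ℝ) : OnePoint E3 := (C.hat t₁ t₂).toPoint

/-- The curvature line parametrization with values in `ℝ³`, where it is finite. -/
def eucl (C : CyclidicSurface) (t₁ t₂ : ℝ) : E3 := (C.hat t₁ t₂).e0⁻¹ • (C.hat t₁ t₂).vec

/-- The oriented unit normal, where the point is finite. -/
def normal (C : CyclidicSurface) (t₁ t₂ : ℝ) : E3 :=
  LieSpace.contactNormal (C.contact t₁ t₂).1 (C.contact t₁ t₂).2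

/-- Unit tangent vector of the first coordinate line. -/
def tangent₁ (C : CyclidicSurface) (t₁ t₂ : ℝ) : E3 :=
  ‖deriv (fun t => C.eucl t t₂) t₁‖⁻¹ • deriv (fun t => C.eucl t t₂) t₁

/-- Unit tangent vector of the second coordinate line. -/
def tangent₂ (C : CyclidicSurface) (t₁ t₂ : ℝ) : E3 :=
  ‖deriv (fun t => C.eucl t₁ t) t₂‖⁻¹ • deriv (fun t => C.eucl t₁ t) t₂

/-- A point is singular if a coordinate line collapses to it, that is, if all curvature circles of
the other family pass through it. -/
def IsSingular (C : CyclidicSurface) (p : OnePoint E3) : Prop :=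
  (∃ t₁, ∀ t₂, C.point t₁ t₂ = p) ∨ (∃ t₂, ∀ t₁, C.point t₁ t₂ = p)

end CyclidicSurface

/-- A cyclidic patch: the restriction of a curvature line parametrization to a closed rectangle
(whose sides do not run through a full circle of parameters). -/
structure CyclidicPatch where
  surface : CyclidicSurface
  a₁ : ℝ
  b₁ : ℝ
  a₂ : ℝ
  b₂ : ℝ
  lt₁ : a₁ < b₁
  lt₂ : a₂ < b₂
  proper₁ : b₁ < a₁ + 2 * Real.pi
  proper₂ : b₂ < a₂ + 2 * Real.pi

namespace CyclidicPatch

/-- End points of the first parameter interval. -/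
def end₁ (f : CyclidicPatch) (i : Bool) : ℝ := if i then f.b₁ else f.a₁

/-- End points of the second parameter interval. -/
def end₂ (f : CyclidicPatch) (j : Bool) : ℝ := if j then f.b₂ else f.a₂

/-- The vertices: `x`, `x₁`, `x₁₂`, `x₂` have the indices `(false, false)`, `(true, false)`,
`(true, true)`, `(false, true)`. -/
def vertex (f : CyclidicPatch) (i j : Bool) : OnePoint E3 :=
  f.surface.point (f.end₁ i) (f.end₂ j)

/-- The boundary arc from `x` to `x₁`. -/
def arc₁ (f : CyclidicPatch) : Set (OnePoint E3) :=
  (fun t => f.surface.point t f.a₂) '' Set.Icc f.a₁ f.b₁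

/-- The boundary arc from `x` to `x₂`. -/
def arc₂ (f : CyclidicPatch) : Set (OnePoint E3) :=
  (fun t => f.surface.point f.a₁ t) '' Set.Icc f.a₂ f.b₂

/-- The vertex frame `(t⁽¹⁾, t⁽²⁾, n)`: the unit tangent vectors of the two boundary arcs,
directed along the arcs to the neighbouring vertices, and the normal of the surface. -/
def vertexFrame (f : CyclidicPatch) (i j : Bool) : Fin 3 → E3 :=
  ![(if i then -1 else 1 : ℝ) • f.surface.tangent₁ (f.end₁ i) (f.end₂ j),
    (if j then -1 else 1 : ℝ) • f.surface.tangent₂ (f.end₁ i) (f.end₂ j),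
    f.surface.normal (f.end₁ i) (f.end₂ j)]

/-- `g` is the restriction of `f` to a smaller closed rectangle. -/
def IsSubpatch (g f : CyclidicPatch) : Prop :=
  g.surface = f.surface ∧ Set.Icc g.a₁ g.b₁ ⊆ Set.Icc f.a₁ f.b₁ ∧
    Set.Icc g.a₂ g.b₂ ⊆ Set.Icc f.a₂ f.b₂

/-- `g` is a subpatch of `f` with the same vertex `x`, whose boundary arcs at `x` are parts of
those of `f` and end in `p₁` and `p₂`. -/
def IsSubpatchWithVertices (g f : CyclidicPatch) (p₁ p₂ : OnePoint E3) : Prop :=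
  g.IsSubpatch f ∧ g.vertex false false = f.vertex false false ∧
    g.arc₁ ⊆ f.arc₁ ∧ g.arc₂ ⊆ f.arc₂ ∧ g.vertex true false = p₁ ∧ g.vertex false true = p₂

end CyclidicPatch

/-- Circles of `ℝ³ ∪ {∞}`: proper circles, and straight lines with the point `∞`. -/
def IsGeneralizedCircle (K : Set (OnePoint E3)) : Prop :=
  (∃ (P : AffineSubspace ℝ E3) (c : E3) (r : ℝ), Module.finrank ℝ P.direction = 2 ∧ c ∈ P ∧
    0 < r ∧ K = (fun y : E3 => (y : OnePoint E3)) '' {y | y ∈ P ∧ dist y c = r}) ∨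
  (∃ (l : AffineSubspace ℝ E3) (c : E3), Module.finrank ℝ l.direction = 1 ∧ c ∈ l ∧
    K = insert OnePoint.infty ((fun y : E3 => (y : OnePoint E3)) '' {y | y ∈ l}))

/-- Points of `ℝ³ ∪ {∞}` are concircular if they lie on a proper circle or a straight line. -/
def Concircular (S : Set (OnePoint E3)) : Prop := ∃ K, IsGeneralizedCircle K ∧ S ⊆ K

/-- Four distinct concircular points: `p` and `q` are separated by `r` and `s` on their circle.
The inversion with centre `p` maps the circle to a line and `p` to `∞`, so this means that the
image of `q` lies strictly between the images of `r` and `s`. -/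
def Separated (p q r s : E3) : Prop :=
  Sbtw ℝ (EuclideanGeometry.inversion p 1 r) (EuclideanGeometry.inversion p 1 q)
    (EuclideanGeometry.inversion p 1 s)

/-- The action on vectors of the reflection in the perpendicular bisecting plane of `p` and `q`. -/
def bisectorReflection (p q v : E3) : E3 :=
  v - (2 * (⟪q - p, v⟫_ℝ / ⟪q - p, q - p⟫_ℝ)) • (q - p)

/-- The frames `B` at `p` and `B'` at `q`, where `p`, `q` are neighbouring vertices and `r`, `s`
the two other vertices, are related by the reflection that interchanges `p` and `q`, composed with
the reversal of the tangent vector number `j` if `p`, `q` are separated by `r`, `s`. -/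
def FramesRelated (j : Fin 3) (p q r s : E3) (B B' : Fin 3 → E3) : Prop :=
  (¬ Separated p q r s → ∀ m, B' m = bisectorReflection p q (B m)) ∧
  (Separated p q r s → ∀ m, B' m = bisectorReflection p q (Function.update B j (-B j) m))

end

/-! Let `s₁(t)`, `s₂(u)` be the enveloping spheres, with `er`-components `ρ₁(t)`, `ρ₂(u)`. The
contact point has the coordinate vector `h = ρ₂ s₁ - ρ₁ s₂`, so `h / (ρ₁ ρ₂) = s₁ / ρ₁ - s₂ / ρ₂` is
a function of `t` plus a function of `u`. Spherical nets have the same structure with other factors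
`ρ₁`, `ρ₂`. At a zero of a factor a coordinate line collapses; elsewhere the coordinate lines are
conics. These facts are collected in `CurvatureNet`.

The alternating sum of `h / (ρ₁ ρ₂)` over the vertices of a rectangle vanishes. Four point vectors
that are linearly dependent with nonzero weights lie on a circle (`concircular_of_sum_eq_zero`), and
the signs of the weights decide separation: the vertices at `t`, `t'` on one side are separated by
the other two iff `ρ₁(t) ρ₁(t') < 0` (`CurvatureNet.separated_iff`).

The reflection interchanging two points `A`, `B` acts on tangent vectors as `W ↦ W - κ A` modulo `B`
(`bisectorReflection_tangentAt`). Along a side, the normals correspond because one sphere touches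
the surface along the whole side. The tangents of the side are reversed because the side is a conic,
and this matches the direction of the vertex frames. The transversal tangents correspond because the
`u`-derivative of `h / (ρ₁ ρ₂)` does not depend on `t`; undoing the normalization gives the sign of
`ρ₁(t) ρ₁(t')`, the same sign that governs separation.

Uniqueness of the subpatch rests on injectivity of the parametrization modulo periods away from
collapsed lines. Only geographic coordinates cover their sphere twice; there the second preimage of
`x` is excluded by the direction in which its meridian arc runs. -/

noncomputable section

open scoped InnerProductSpace

open LieSpace

/-! ### Points and tangent vectors in homogeneous coordinates -/

namespace LieSpace

variable {A B W y z : LieSpace} {a : ℝ}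

@[simp] lemma vec_add : (y + z).vec = y.vec + z.vec := rfl
@[simp] lemma vec_sub : (y - z).vec = y.vec - z.vec := rfl
@[simp] lemma vec_smul : (a • y).vec = a • y.vec := rfl
@[simp] lemma e0_add : (y + z).e0 = y.e0 + z.e0 := rfl
@[simp] lemma e0_sub : (y - z).e0 = y.e0 - z.e0 := rfl
@[simp] lemma e0_smul : (a • y).e0 = a * y.e0 := rfl
@[simp] lemma eInf_add : (y + z).eInf = y.eInf + z.eInf := rfl
@[simp] lemma eInf_sub : (y - z).eInf = y.eInf - z.eInf := rfl
@[simp] lemma eInf_smul : (a • y).eInf = a * y.eInf := rfl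
@[simp] lemma er_add : (y + z).er = y.er + z.er := rfl
@[simp] lemma er_sub : (y - z).er = y.er - z.er := rfl
@[simp] lemma er_smul : (a • y).er = a * y.er := rfl
@[simp] lemma vec_zero : (0 : LieSpace).vec = 0 := rfl
@[simp] lemma e0_zero : (0 : LieSpace).e0 = 0 := rfl
@[simp] lemma eInf_zero : (0 : LieSpace).eInf = 0 := rfl
@[simp] lemma er_zero : (0 : LieSpace).er = 0 := rfl

lemma ext_components (hv : y.vec = z.vec) (h0 : y.e0 = z.e0) (hi : y.eInf = z.eInf)
    (hr : y.er = z.er) : y = z :=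
  Prod.ext hv (Prod.ext h0 (Prod.ext hi hr))

lemma form_comm (y z : LieSpace) : form y z = form z y := by
  simp only [form, real_inner_comm]; ring

@[simp] lemma form_add_left (x y z : LieSpace) : form (x + y) z = form x z + form y z := by
  simp only [form, vec_add, inner_add_left, e0_add, eInf_add, er_add]; ring

@[simp] lemma form_smul_left (a : ℝ) (y z : LieSpace) : form (a • y) z = a * form y z := by
  simp only [form, vec_smul, real_inner_smul_left, e0_smul, eInf_smul, er_smul]; ring

@[simp] lemma form_sub_left (x y z : LieSpace) : form (x - y) z = form x z - form y z := by
  simp only [form, vec_sub, inner_sub_left, e0_sub, eInf_sub, er_sub]; ring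

@[simp] lemma form_add_right (x y z : LieSpace) : form x (y + z) = form x y + form x z := by
  simp only [form_comm x, form_add_left]

@[simp] lemma form_smul_right (a : ℝ) (y z : LieSpace) : form y (a • z) = a * form y z := by
  simp only [form_comm y, form_smul_left]

@[simp] lemma form_sub_right (x y z : LieSpace) : form x (y - z) = form x y - form x z := by
  simp only [form_comm x, form_sub_left]

@[simp] lemma form_zero_left (y : LieSpace) : form 0 y = 0 := by simp [form]

@[simp] lemma form_zero_right (y : LieSpace) : form y 0 = 0 := by simp [form]

/-- Isotropic vectors without `e_r`-component: homogeneous coordinates of points. -/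
structure IsPoint (A : LieSpace) : Prop where
  isotropic : form A A = 0
  er : A.er = 0

/-- The point of Euclidean space with given homogeneous coordinates, if it is finite. -/
def affinePoint (A : LieSpace) : E3 := A.e0⁻¹ • A.vec

/-- The action of a tangent vector in homogeneous coordinates at the point `p`. -/
def tangentAt (p : E3) (W : LieSpace) : E3 := W.vec - W.e0 • p

lemma IsPoint.smul (hA : A.IsPoint) (a : ℝ) : (a • A).IsPoint :=
  ⟨by simp [hA.isotropic], by simp [hA.er]⟩

lemma affinePoint_smul {a : ℝ} (ha : a ≠ 0) : (a • A).affinePoint = A.affinePoint := by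
  simp only [affinePoint, e0_smul, vec_smul, smul_smul]
  congr 1
  field_simp

lemma vec_eq (h0 : A.e0 ≠ 0) : A.vec = A.e0 • A.affinePoint := by
  rw [affinePoint, smul_inv_smul₀ h0]

lemma IsPoint.eInf_eq (hA : A.IsPoint) (h0 : A.e0 ≠ 0) :
    A.eInf = A.e0 * ⟪A.affinePoint, A.affinePoint⟫_ℝ := by
  have h := hA.isotropic
  simp only [form, hA.er, vec_eq h0, real_inner_smul_left, real_inner_smul_right] at h
  have : A.e0 * (A.e0 * ⟪A.affinePoint, A.affinePoint⟫_ℝ - A.eInf) = 0 := by linarith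
  have := (mul_eq_zero.1 this).resolve_left h0
  linarith

lemma IsPoint.form_eq (hA : A.IsPoint) (h0 : A.e0 ≠ 0) (W : LieSpace) :
    form A W = A.e0 * (⟪A.affinePoint, W.vec⟫_ℝ -
      (W.eInf + ⟪A.affinePoint, A.affinePoint⟫_ℝ * W.e0) / 2) := by
  rw [form, hA.er, hA.eInf_eq h0, vec_eq h0, real_inner_smul_left]; ring

lemma IsPoint.inner_affinePoint (hA : A.IsPoint) (h0 : A.e0 ≠ 0) (hW : form A W = 0) :
    ⟪A.affinePoint, W.vec⟫_ℝ = (W.eInf + ⟪A.affinePoint, A.affinePoint⟫_ℝ * W.e0) / 2 := by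
  rw [hA.form_eq h0] at hW
  have := (mul_eq_zero.1 hW).resolve_left h0
  linarith

lemma IsPoint.form_eq_dist (hA : A.IsPoint) (hB : B.IsPoint) (hA0 : A.e0 ≠ 0) (hB0 : B.e0 ≠ 0) :
    form A B = -(A.e0 * B.e0 / 2) *
      ⟪B.affinePoint - A.affinePoint, B.affinePoint - A.affinePoint⟫_ℝ := by
  rw [hA.form_eq hA0, hB.eInf_eq hB0, vec_eq hB0, inner_sub_left, inner_sub_right, inner_sub_right,
    real_inner_smul_right, real_inner_comm A.affinePoint B.affinePoint]
  ring

/-- Subtracting from `W` the multiple of `A` that removes its `e0`-component changes neither its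
`er`-component nor its products with vectors orthogonal to the isotropic `A`, and leaves `tangentAt`
as Euclidean part. -/
lemma IsPoint.inner_tangentAt (hA : A.IsPoint) (h0 : A.e0 ≠ 0) {W W' : LieSpace}
    (hW : form A W = 0) (hW' : form A W' = 0) :
    ⟪tangentAt A.affinePoint W, tangentAt A.affinePoint W'⟫_ℝ = form W W' + W.er * W'.er := by
  have h := hA.inner_affinePoint h0 hW
  have h' := hA.inner_affinePoint h0 hW'
  simp only [tangentAt, form, inner_sub_left, inner_sub_right, real_inner_smul_left,
    real_inner_smul_right]
  rw [real_inner_comm A.affinePoint W.vec, h, h']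
  ring

@[simp] lemma tangentAt_self (h0 : A.e0 ≠ 0) : tangentAt A.affinePoint A = 0 := by
  rw [tangentAt, vec_eq h0, sub_self]

@[simp] lemma tangentAt_sub (p : E3) (y z : LieSpace) :
    tangentAt p (y - z) = tangentAt p y - tangentAt p z := by
  simp only [tangentAt, vec_sub, e0_sub]; module

@[simp] lemma tangentAt_smul (p : E3) (a : ℝ) (y : LieSpace) :
    tangentAt p (a • y) = a • tangentAt p y := by
  simp only [tangentAt, vec_smul, e0_smul]; module

/-- The reflection that interchanges two points, on tangent vectors in homogeneous coordinates. -/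
lemma IsPoint.bisectorReflection_tangentAt (hA : A.IsPoint) (hB : B.IsPoint) (hA0 : A.e0 ≠ 0)
    (hB0 : B.e0 ≠ 0) (hne : A.affinePoint ≠ B.affinePoint) {κ : ℝ} (hW : form A W = 0)
    (hκ : form B W = κ * form A B) :
    bisectorReflection A.affinePoint B.affinePoint (tangentAt A.affinePoint W) =
      tangentAt B.affinePoint (W - κ • A) := by
  have hAB := hA.form_eq_dist hB hA0 hB0
  have hd : ⟪B.affinePoint - A.affinePoint, B.affinePoint - A.affinePoint⟫_ℝ ≠ 0 := by
    rw [Ne, inner_self_eq_zero, sub_eq_zero]; exact hne.symm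
  have hBW := hB.form_eq hB0 W
  have hAW := hA.inner_affinePoint hA0 hW
  set a := A.affinePoint with ha
  set b := B.affinePoint with hb
  -- Only the component along `b - a` enters the reflection, and it is determined by the product of
  -- `W` with `B`. In `ℝ^{4,2}` this is the reflection in `A / A.e0 - B / B.e0`, which sends `W` to
  -- `W - κ A` plus a multiple of `B`; `tangentAt` at `b` kills the latter.
  have key : ⟪b - a, tangentAt a W⟫_ℝ = (W.e0 - κ * A.e0) / 2 * ⟪b - a, b - a⟫_ℝ := by
    have hBW' : ⟪b, W.vec⟫_ℝ - (W.eInf + ⟪b, b⟫_ℝ * W.e0) / 2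
        = -(κ * A.e0 / 2) * ⟪b - a, b - a⟫_ℝ := by
      apply mul_left_cancel₀ hB0
      rw [← hBW, hκ, hAB]; ring
    have e1 : ⟪b - a, b - a⟫_ℝ = ⟪b, b⟫_ℝ - 2 * ⟪a, b⟫_ℝ + ⟪a, a⟫_ℝ := by
      rw [inner_sub_left, inner_sub_right, inner_sub_right, real_inner_comm a b]; ring
    have e2 : ⟪b - a, tangentAt a W⟫_ℝ =
        ⟪b, W.vec⟫_ℝ - ⟪a, W.vec⟫_ℝ - W.e0 * ⟪a, b⟫_ℝ + W.e0 * ⟪a, a⟫_ℝ := by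
      rw [tangentAt, inner_sub_left, inner_sub_right, inner_sub_right, real_inner_smul_right,
        real_inner_smul_right, real_inner_comm a b]; ring
    rw [e2, hAW]
    linear_combination hBW' - W.e0 / 2 * e1
  rw [bisectorReflection, key, mul_div_assoc, div_self hd, tangentAt, tangentAt, vec_sub, e0_sub,
    vec_smul, e0_smul, vec_eq hA0, ← ha]
  module

lemma toPoint_of_e0_ne_zero (h0 : A.e0 ≠ 0) : A.toPoint = (A.affinePoint : OnePoint E3) := by
  rw [toPoint, if_neg h0, affinePoint]

lemma toPoint_of_e0_eq_zero (h0 : A.e0 = 0) : A.toPoint = OnePoint.infty := by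
  rw [toPoint, if_pos h0]

lemma toPoint_smul {a : ℝ} (ha : a ≠ 0) (A : LieSpace) : (a • A).toPoint = A.toPoint := by
  by_cases h0 : A.e0 = 0
  · rw [toPoint_of_e0_eq_zero h0, toPoint_of_e0_eq_zero (by simp [h0])]
  · rw [toPoint_of_e0_ne_zero h0, toPoint_of_e0_ne_zero (by simp [h0, ha])]
    rw [affinePoint_smul ha]

lemma e0_ne_zero_of_toPoint_eq {p : E3} (h : A.toPoint = p) : A.e0 ≠ 0 := by
  intro h0
  rw [toPoint_of_e0_eq_zero h0] at h
  exact OnePoint.infty_ne_coe p h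

lemma affinePoint_of_toPoint_eq {p : E3} (h : A.toPoint = p) : A.affinePoint = p := by
  rw [toPoint_of_e0_ne_zero (e0_ne_zero_of_toPoint_eq h)] at h
  exact OnePoint.coe_injective h

lemma IsPoint.vec_eq_zero (hA : A.IsPoint) (h0 : A.e0 = 0) : A.vec = 0 := by
  have h := hA.isotropic
  simpa [form, h0, hA.er] using h

lemma IsPoint.form_eq_zero_of_toPoint_eq (hA : A.IsPoint) (hB : B.IsPoint)
    (h : A.toPoint = B.toPoint) : form A B = 0 := by
  by_cases hA0 : A.e0 = 0
  · have hB0 : B.e0 = 0 := by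
      by_contra hB0
      rw [toPoint_of_e0_eq_zero hA0, toPoint_of_e0_ne_zero hB0] at h
      exact OnePoint.infty_ne_coe _ h
    simp [form, hA0, hB0, hA.er, hA.vec_eq_zero hA0]
  · have hB0 : B.e0 ≠ 0 := by
      intro hB0
      rw [toPoint_of_e0_eq_zero hB0, toPoint_of_e0_ne_zero hA0] at h
      exact OnePoint.infty_ne_coe _ h.symm
    rw [toPoint_of_e0_ne_zero hA0, toPoint_of_e0_ne_zero hB0] at h
    rw [hA.form_eq_dist hB hA0 hB0, OnePoint.coe_injective h]
    simp

/-- Points in oriented contact coincide. -/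
lemma IsPoint.exists_smul_of_form_eq_zero (hA : A.IsPoint) (hB : B.IsPoint) (hA' : A ≠ 0)
    (hB' : B ≠ 0) (h : form A B = 0) : ∃ a : ℝ, a ≠ 0 ∧ B = a • A := by
  have inf {A : LieSpace} (hA : A.IsPoint) (hA' : A ≠ 0) (hA0 : A.e0 = 0) : A.eInf ≠ 0 := by
    intro hi
    exact hA' (ext_components (hA.vec_eq_zero hA0) hA0 hi hA.er)
  by_cases hA0 : A.e0 = 0
  · have hAi := inf hA hA' hA0
    have hB0 : B.e0 = 0 := by
      simpa [form, hA0, hA.vec_eq_zero hA0, hA.er, hAi] using h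
    have hBi := inf hB hB' hB0
    refine ⟨B.eInf / A.eInf, div_ne_zero hBi hAi, ext_components ?_ ?_ ?_ ?_⟩
    · simp [hA.vec_eq_zero hA0, hB.vec_eq_zero hB0]
    · simp [hA0, hB0]
    · simp [hAi]
    · simp [hA.er, hB.er]
  · have hB0 : B.e0 ≠ 0 := by
      intro hB0
      have hBi := inf hB hB' hB0
      exact hA0 (by simpa [form, hB0, hB.vec_eq_zero hB0, hA.er, hBi] using h)
    rw [hA.form_eq_dist hB hA0 hB0] at h
    have h1 : ⟪B.affinePoint - A.affinePoint, B.affinePoint - A.affinePoint⟫_ℝ = 0 := by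
      refine (mul_eq_zero.1 h).resolve_left ?_
      exact neg_ne_zero.2 (div_ne_zero (mul_ne_zero hA0 hB0) two_ne_zero)
    rw [inner_self_eq_zero, sub_eq_zero] at h1
    refine ⟨B.e0 / A.e0, div_ne_zero hB0 hA0, ext_components ?_ ?_ ?_ ?_⟩
    · rw [vec_smul, vec_eq hB0, vec_eq hA0, h1, smul_smul, div_mul_cancel₀ _ hA0]
    · simp [hA0]
    · rw [eInf_smul, hB.eInf_eq hB0, hA.eInf_eq hA0, h1]; field_simp
    · simp [hA.er, hB.er]

lemma IsPoint.toPoint_eq_iff (hA : A.IsPoint) (hB : B.IsPoint) (hA' : A ≠ 0) (hB' : B ≠ 0) :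
    A.toPoint = B.toPoint ↔ form A B = 0 := by
  refine ⟨hA.form_eq_zero_of_toPoint_eq hB, fun h => ?_⟩
  obtain ⟨a, ha, rfl⟩ := hA.exists_smul_of_form_eq_zero hB hA' hB' h
  rw [toPoint_smul ha]

/-- The linear map of Euclidean parts. -/
def vecL : LieSpace →L[ℝ] E3 := ContinuousLinearMap.fst ℝ _ _

/-- The linear form of `e₀`-components. -/
def e0L : LieSpace →L[ℝ] ℝ :=
  (ContinuousLinearMap.fst ℝ _ _).comp (ContinuousLinearMap.snd ℝ _ _)

/-- The linear form of `e_r`-components. -/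
def erL : LieSpace →L[ℝ] ℝ :=
  (ContinuousLinearMap.snd ℝ _ _).comp
    ((ContinuousLinearMap.snd ℝ _ _).comp (ContinuousLinearMap.snd ℝ _ _))

/-- The linear form of `e_∞`-components. -/
def eInfL : LieSpace →L[ℝ] ℝ :=
  (ContinuousLinearMap.fst ℝ _ _).comp
    ((ContinuousLinearMap.snd ℝ _ _).comp (ContinuousLinearMap.snd ℝ _ _))

/-! ### Derivatives of curves in homogeneous coordinates -/

variable {h : ℝ → LieSpace} {h' : LieSpace} {t : ℝ}

lemma hasDerivAt_vec (hh : HasDerivAt h h' t) : HasDerivAt (fun s => (h s).vec) h'.vec t :=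
  vecL.hasFDerivAt.comp_hasDerivAt t hh

lemma hasDerivAt_e0 (hh : HasDerivAt h h' t) : HasDerivAt (fun s => (h s).e0) h'.e0 t :=
  e0L.hasFDerivAt.comp_hasDerivAt t hh

lemma hasDerivAt_eInf (hh : HasDerivAt h h' t) : HasDerivAt (fun s => (h s).eInf) h'.eInf t :=
  eInfL.hasFDerivAt.comp_hasDerivAt t hh

lemma hasDerivAt_er (hh : HasDerivAt h h' t) : HasDerivAt (fun s => (h s).er) h'.er t :=
  erL.hasFDerivAt.comp_hasDerivAt t hh

lemma hasDerivAt_form (hh : HasDerivAt h h' t) (W : LieSpace) :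
    HasDerivAt (fun s => form (h s) W) (form h' W) t := by
  have h1 := (hasDerivAt_vec hh).inner ℝ (hasDerivAt_const t W.vec)
  have h2 := ((hasDerivAt_e0 hh).mul_const W.eInf).add ((hasDerivAt_eInf hh).mul_const W.e0)
  have h3 := (h1.sub (h2.div_const 2)).sub ((hasDerivAt_er hh).mul_const W.er)
  refine h3.congr_deriv ?_
  simp [form]

lemma hasDerivAt_affinePoint (hh : HasDerivAt h h' t) (h0 : (h t).e0 ≠ 0) :
    HasDerivAt (fun s => (h s).affinePoint)
      ((h t).e0⁻¹ • tangentAt (h t).affinePoint h') t := by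
  refine (((hasDerivAt_e0 hh).inv h0).smul (hasDerivAt_vec hh)).congr_deriv ?_
  rw [tangentAt, vec_eq h0]
  match_scalars
  · simp
  · field_simp

end LieSpace

/-! ### Contact elements and conics -/

namespace LieSpace

/-- The span of `y` and `z` contains the vector with `e0 = 0` and `er = 1` whose Euclidean part is
the normal. Subtracting `y.er` times this vector from `y` leaves a multiple of the contact point,
which `tangentAt` kills. -/
lemma tangentAt_contact_left {y z : LieSpace} (h0 : (contactVec y z).e0 ≠ 0) :
    y.er • contactNormal y z = tangentAt (contactVec y z).affinePoint y := by
  have h1 : (contactVec y z).e0 = y.e0 * z.er - z.e0 * y.er := by simp [contactVec]; ring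
  rw [contactNormal, tangentAt, affinePoint, ← h1]
  rw [h1] at h0
  simp only [contactVec, vec_sub, vec_smul, e0_sub, e0_smul, smul_smul, smul_sub]
  have h2 : z.er * y.e0 - y.er * z.e0 ≠ 0 := by convert h0 using 1; ring
  match_scalars
  · field_simp
  · field_simp; ring

lemma tangentAt_contact_right {y z : LieSpace} (h0 : (contactVec y z).e0 ≠ 0) :
    z.er • contactNormal y z = tangentAt (contactVec y z).affinePoint z := by
  have h1 : (contactVec y z).e0 = y.e0 * z.er - z.e0 * y.er := by simp [contactVec]; ring
  rw [contactNormal, tangentAt, affinePoint, ← h1]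
  rw [h1] at h0
  simp only [contactVec, vec_sub, vec_smul, e0_sub, e0_smul, smul_smul, smul_sub]
  have h2 : z.er * y.e0 - y.er * z.e0 ≠ 0 := by convert h0 using 1; ring
  match_scalars
  · field_simp; ring
  · field_simp

/-- The Gram matrix of `U`, `V`, `K` is `c²` times that of an orthonormal basis of signature
`(+,+,-)`. -/
structure IsConicFrame (U V K : LieSpace) (c : ℝ) : Prop where
  UU : form U U = c ^ 2
  VV : form V V = c ^ 2
  KK : form K K = -c ^ 2
  UV : form U V = 0
  UK : form U K = 0
  VK : form V K = 0

/-- The trigonometric parametrization of a conic. -/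
def conic (U V K : LieSpace) (t : ℝ) : LieSpace := Real.cos t • U + Real.sin t • V + K

/-- The derivative of `conic`. -/
def conicDeriv (U V : LieSpace) (t : ℝ) : LieSpace := -Real.sin t • U + Real.cos t • V

lemma hasDerivAt_conic (U V K : LieSpace) (t : ℝ) :
    HasDerivAt (conic U V K) (conicDeriv U V t) t :=
  (((Real.hasDerivAt_cos t).smul_const U).add ((Real.hasDerivAt_sin t).smul_const V)).add_const K

namespace IsConicFrame

variable {U V K : LieSpace} {c : ℝ}

lemma form_conic (H : IsConicFrame U V K c) (s t : ℝ) :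
    form (conic U V K s) (conic U V K t) = c ^ 2 * (Real.cos (t - s) - 1) := by
  simp only [conic, form_add_left, form_add_right, form_smul_left, form_smul_right, H.UU, H.VV,
    H.KK, H.UV, H.UK, H.VK, form_comm V U, form_comm K U, form_comm K V, Real.cos_sub]
  ring

lemma form_conic_conicDeriv (H : IsConicFrame U V K c) (s t : ℝ) :
    form (conic U V K s) (conicDeriv U V t) = -(c ^ 2 * Real.sin (t - s)) := by
  simp only [conic, conicDeriv, form_add_left, form_add_right, form_smul_left, form_smul_right,
    H.UU, H.VV, H.UV, H.UK, H.VK, form_comm V U, form_comm K U, form_comm K V, Real.sin_sub]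
  ring

lemma form_conicDeriv_self (H : IsConicFrame U V K c) (t : ℝ) :
    form (conicDeriv U V t) (conicDeriv U V t) = c ^ 2 := by
  simp only [conicDeriv, form_add_left, form_add_right, form_smul_left, form_smul_right,
    H.UU, H.VV, H.UV, form_comm V U]
  linear_combination c ^ 2 * Real.sin_sq_add_cos_sq t

end IsConicFrame

/-- Both the sum of the derivatives and the chord are multiples of the derivative at the mean
parameter; their ratio is the cotangent of half the parameter difference. -/
lemma conicDeriv_add_conicDeriv (U V K : LieSpace) (s t : ℝ) :
    (1 - Real.cos (t - s)) • (conicDeriv U V s + conicDeriv U V t) =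
      Real.sin (t - s) • (conic U V K t - conic U V K s) := by
  have h1 := Real.sin_sq_add_cos_sq s
  have h2 := Real.sin_sq_add_cos_sq t
  rw [Real.cos_sub, Real.sin_sub]
  simp only [conicDeriv, conic]
  match_scalars
  · linear_combination Real.sin s * h2 + Real.sin t * h1
  · linear_combination (-Real.cos s) * h2 - Real.cos t * h1
  · ring

lemma er_conicDeriv {U V K : LieSpace} (h : ∀ t, (conic U V K t).er = 0) (t : ℝ) :
    (conicDeriv U V t).er = 0 := by
  have h0 := h 0
  have h1 := h Real.pi
  have h2 := h (Real.pi / 2)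
  simp only [conic, er_add, er_smul, Real.cos_zero, Real.sin_zero, Real.cos_pi, Real.sin_pi,
    Real.cos_pi_div_two, Real.sin_pi_div_two] at h0 h1 h2
  have hU : U.er = 0 := by linarith
  have hV : V.er = 0 := by linarith
  simp only [conicDeriv, er_add, er_smul, hU, hV, mul_zero, add_zero]

/-! ### Separation of point pairs on a circle -/

section Separated

variable {A B C D : LieSpace}

/-- By `h1` and `h2`, `αβ` has the sign of `γδ` and `αδ` that of `βγ`. If `αβ < 0`, the only
competing pattern has `β`, `δ` of one sign and `α`, `γ` of the other; `h3` excludes it. -/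
lemma sign_pattern {α β γ δ ab cd ad bc : ℝ} (hα : α ≠ 0) (hβ : β ≠ 0) (hγ : γ ≠ 0) (hδ : δ ≠ 0)
    (hab : 0 < ab) (hcd : 0 < cd) (had : 0 < ad) (hbc : 0 < bc)
    (h1 : α * β * ab = γ * δ * cd) (h2 : α * δ * ad = β * γ * bc) (h3 : β + δ = α + γ) :
    (0 < γ * β ∧ β * δ < 0) ↔ α * β < 0 := by
  have e1 : 0 < α * β ↔ 0 < γ * δ := by
    rw [← mul_pos_iff_of_pos_right hab, h1, mul_pos_iff_of_pos_right hcd]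
  have e2 : 0 < α * δ ↔ 0 < β * γ := by
    rw [← mul_pos_iff_of_pos_right had, h2, mul_pos_iff_of_pos_right hbc]
  rw [mul_pos_iff, mul_neg_iff, mul_neg_iff]
  rw [mul_pos_iff, mul_pos_iff] at e1 e2
  rcases lt_or_gt_of_ne hβ with hβ | hβ <;> rcases lt_or_gt_of_ne hα with hα | hα <;>
    rcases lt_or_gt_of_ne hγ with hγ | hγ <;> rcases lt_or_gt_of_ne hδ with hδ | hδ <;>
    grind

/-- This is what squaring `A - B = D - C`, `A - D = B - C` and `A + C = B + D` gives for isotropic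
vectors. -/
lemma form_eq_of_alternating_sum (hA : A.IsPoint) (hB : B.IsPoint) (hC : C.IsPoint)
    (hD : D.IsPoint) (h : A - B + C - D = 0) :
    form A B = form C D ∧ form A D = form B C ∧ form A C = form B D := by
  have hA' := congrArg (form A) h
  have hB' := congrArg (form B) h
  have hC' := congrArg (form C) h
  have hD' := congrArg (form D) h
  simp only [form_sub_right, form_add_right, form_zero_right, hA.isotropic, hB.isotropic,
    hC.isotropic, hD.isotropic, form_comm B A, form_comm C A, form_comm D A, form_comm C B,
    form_comm D B, form_comm D C] at hA' hB' hC' hD'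
  exact ⟨by linarith, by linarith, by linarith⟩

lemma inner_self_sub_pos {a b : E3} (h : a ≠ b) : 0 < ⟪b - a, b - a⟫_ℝ :=
  real_inner_self_pos.2 (sub_ne_zero.2 h.symm)

/-- With respect to the origin `a`, the `vec`-part of the relation is linear in `b - a`, `c - a`, `d
- a`, and its product with `A` is the same relation between squared distances. Hence the inverted
point of `b` is an affine combination of those of `c` and `d`. The coefficient `σ` of `c` has the
sign of `γβ`, and `1 - σ` that of `-βδ`; `sign_pattern` rewrites `0 < σ < 1`. -/
lemma separated_iff (hA : A.IsPoint) (hB : B.IsPoint) (hC : C.IsPoint) (hD : D.IsPoint)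
    (hA0 : A.e0 ≠ 0) (hB0 : B.e0 ≠ 0) (hC0 : C.e0 ≠ 0) (hD0 : D.e0 ≠ 0)
    (hab : A.affinePoint ≠ B.affinePoint) (hac : A.affinePoint ≠ C.affinePoint)
    (had : A.affinePoint ≠ D.affinePoint) (hbc : B.affinePoint ≠ C.affinePoint)
    (hcd : C.affinePoint ≠ D.affinePoint) (h : A - B + C - D = 0) :
    Separated A.affinePoint B.affinePoint D.affinePoint C.affinePoint ↔ A.e0 * B.e0 < 0 := by
  obtain ⟨f1, f2, -⟩ := form_eq_of_alternating_sum hA hB hC hD h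
  have f4 := congrArg (form A) h
  simp only [form_sub_right, form_add_right, form_zero_right, hA.isotropic] at f4
  rw [hA.form_eq_dist hB hA0 hB0, hC.form_eq_dist hD hC0 hD0] at f1
  rw [hA.form_eq_dist hD hA0 hD0, hB.form_eq_dist hC hB0 hC0] at f2
  rw [hA.form_eq_dist hB hA0 hB0, hA.form_eq_dist hC hA0 hC0, hA.form_eq_dist hD hA0 hD0] at f4
  have f3 := congrArg e0 h
  have fv := congrArg vec h
  simp only [e0_sub, e0_add, e0_zero] at f3
  simp only [vec_sub, vec_add, vec_zero, vec_eq hA0, vec_eq hB0, vec_eq hC0, vec_eq hD0] at fv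
  have pab := inner_self_sub_pos hab
  have pac := inner_self_sub_pos hac
  have pad := inner_self_sub_pos had
  have pbc := inner_self_sub_pos hbc
  have pcd := inner_self_sub_pos hcd
  generalize A.affinePoint = a at *
  generalize B.affinePoint = b at *
  generalize C.affinePoint = c at *
  generalize D.affinePoint = d at *
  generalize A.e0 = α at *
  generalize B.e0 = β at *
  generalize C.e0 = γ at *
  generalize D.e0 = δ at *
  have inv (x : E3) : EuclideanGeometry.inversion a 1 x = (⟪x - a, x - a⟫_ℝ)⁻¹ • (x - a) + a := by
    rw [EuclideanGeometry.inversion, real_inner_self_eq_norm_sq, dist_eq_norm, div_pow, one_pow,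
      one_div]
    rfl
  have g4 : β * ⟪b - a, b - a⟫_ℝ = γ * ⟪c - a, c - a⟫_ℝ - δ * ⟪d - a, d - a⟫_ℝ := by
    have : α * (β * ⟪b - a, b - a⟫_ℝ) = α * (γ * ⟪c - a, c - a⟫_ℝ - δ * ⟪d - a, d - a⟫_ℝ) := by
      linarith
    exact mul_left_cancel₀ hA0 this
  have gv : β • (b - a) = γ • (c - a) - δ • (d - a) := by
    have hα : α = β - γ + δ := by linarith
    rw [hα] at fv
    rw [← sub_eq_zero, ← neg_eq_zero, ← fv]
    module
  have hβ' : β * ⟪b - a, b - a⟫_ℝ ≠ 0 := mul_ne_zero hB0 pab.ne'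
  obtain ⟨σ, hσ⟩ : ∃ σ, σ = γ * ⟪c - a, c - a⟫_ℝ / (β * ⟪b - a, b - a⟫_ℝ) := ⟨_, rfl⟩
  have hσ' : 1 - σ = -(δ * ⟪d - a, d - a⟫_ℝ) / (β * ⟪b - a, b - a⟫_ℝ) := by
    rw [hσ, eq_div_iff hβ', sub_mul, div_mul_cancel₀ _ hβ', g4]; ring
  have hline : AffineMap.lineMap (EuclideanGeometry.inversion a 1 d)
      (EuclideanGeometry.inversion a 1 c) σ = EuclideanGeometry.inversion a 1 b := by
    have e1 : σ * (⟪c - a, c - a⟫_ℝ)⁻¹ = (β * ⟪b - a, b - a⟫_ℝ)⁻¹ * γ := by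
      rw [hσ]; field_simp
    have e2 : (1 - σ) * (⟪d - a, d - a⟫_ℝ)⁻¹ = -((β * ⟪b - a, b - a⟫_ℝ)⁻¹ * δ) := by
      rw [hσ']; field_simp
    have e3 : (⟪b - a, b - a⟫_ℝ)⁻¹ = (β * ⟪b - a, b - a⟫_ℝ)⁻¹ * β := by field_simp
    calc _ = (σ * (⟪c - a, c - a⟫_ℝ)⁻¹) • (c - a)
          + ((1 - σ) * (⟪d - a, d - a⟫_ℝ)⁻¹) • (d - a) + a := by
          rw [AffineMap.lineMap_apply_module, inv, inv]; module
      _ = (β * ⟪b - a, b - a⟫_ℝ)⁻¹ • (γ • (c - a) - δ • (d - a)) + a := by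
          rw [e1, e2]; module
      _ = _ := by rw [← gv, inv, e3]; module
  have hne : EuclideanGeometry.inversion a 1 d ≠ EuclideanGeometry.inversion a 1 c :=
    fun h => hcd (EuclideanGeometry.inversion_injective a one_ne_zero h).symm
  have h01 : σ ∈ Set.Ioo (0 : ℝ) 1 ↔ 0 < γ * β ∧ β * δ < 0 := by
    have k : 0 < ⟪b - a, b - a⟫_ℝ * β ^ 2 := by positivity
    have k1 : σ = γ * β * (⟪c - a, c - a⟫_ℝ / (⟪b - a, b - a⟫_ℝ * β ^ 2)) := by
      rw [hσ]; field_simp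
    have k2 : 1 - σ = -(β * δ) * (⟪d - a, d - a⟫_ℝ / (⟪b - a, b - a⟫_ℝ * β ^ 2)) := by
      rw [hσ']; field_simp
    rw [Set.mem_Ioo, ← sub_pos (a := (1 : ℝ)), k2, mul_pos_iff_of_pos_right (div_pos pad k), k1,
      mul_pos_iff_of_pos_right (div_pos pac k), neg_pos]
  rw [Separated, sbtw_iff_mem_image_Ioo_and_ne, ← sign_pattern hA0 hB0 hC0 hD0 pab pcd pad pbc
    (by linarith) (by linarith) (by linarith), ← h01, and_iff_left hne]
  refine ⟨?_, fun h => ⟨σ, h, hline⟩⟩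
  rintro ⟨s, hs, h⟩
  rwa [← AffineMap.lineMap_injective ℝ hne (h.trans hline.symm)]

end Separated

end LieSpace

/-! ### Reflections and unit vectors -/

lemma norm_bisectorReflection {p q : E3} (v : E3) (h : p ≠ q) :
    ‖bisectorReflection p q v‖ = ‖v‖ := by
  have h1 := inner_self_sub_pos h
  have h2 : ‖bisectorReflection p q v‖ ^ 2 = ‖v‖ ^ 2 := by
    rw [← real_inner_self_eq_norm_sq, ← real_inner_self_eq_norm_sq, bisectorReflection]
    generalize q - p = d at *
    simp only [inner_sub_left, inner_sub_right, real_inner_smul_left, real_inner_smul_right,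
      real_inner_comm d v]
    field_simp
    ring
  rwa [sq_eq_sq₀ (norm_nonneg _) (norm_nonneg _)] at h2

lemma bisectorReflection_smul (p q v : E3) (a : ℝ) :
    bisectorReflection p q (a • v) = a • bisectorReflection p q v := by
  simp only [bisectorReflection, real_inner_smul_right]; module

lemma bisectorReflection_neg (p q v : E3) :
    bisectorReflection p q (-v) = -bisectorReflection p q v := by
  rw [← neg_one_smul ℝ v, bisectorReflection_smul, neg_one_smul]

/-- The unit vector in the direction of `v`. -/
def unitVector (v : E3) : E3 := ‖v‖⁻¹ • v

lemma bisectorReflection_unitVector_of_pos {p q v w : E3} (h : p ≠ q) {k : ℝ} (hk : 0 < k)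
    (hv : bisectorReflection p q v = k • w) :
    bisectorReflection p q (unitVector v) = unitVector w := by
  have h1 : ‖v‖ = k * ‖w‖ := by
    rw [← norm_bisectorReflection v h, hv, norm_smul, Real.norm_of_nonneg hk.le]
  rw [unitVector, bisectorReflection_smul, hv, h1, unitVector, smul_smul]
  congr 1
  field_simp

lemma bisectorReflection_unitVector_of_neg {p q v w : E3} (h : p ≠ q) {k : ℝ} (hk : k < 0)
    (hv : bisectorReflection p q v = k • w) :
    bisectorReflection p q (unitVector v) = -unitVector w := by
  rw [bisectorReflection_unitVector_of_pos h (neg_pos.2 hk) (w := -w) (by rw [hv]; module)]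
  simp [unitVector]

lemma norm_unitVector {v : E3} (h : v ≠ 0) : ‖unitVector v‖ = 1 := by
  rw [unitVector, norm_smul, norm_inv, norm_norm, inv_mul_cancel₀ (norm_ne_zero_iff.2 h)]

/-- A surface with curvature line parametrization `h` and normal `n`, where `h` is, away from
the zeros of `ρ₁` and `ρ₂`, up to the factor `ρ₁ ρ₂` the sum of functions of one variable, and
where the coordinate lines are conics along which a fixed sphere is tangent to the surface. -/
structure CurvatureNet (h : ℝ → ℝ → LieSpace) (n : ℝ → ℝ → E3) (ρ₁ ρ₂ : ℝ → ℝ) : Prop where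
  er : ∀ t u, (h t u).er = 0
  differentiable₁ : Differentiable ℝ ρ₁
  differentiable₂ : Differentiable ℝ ρ₂
  line₁ : ∀ u, ρ₂ u ≠ 0 → ∃ U V K, IsConicFrame U V K (ρ₂ u) ∧ ∀ t, h t u = conic U V K t
  line₂ : ∀ t, ρ₁ t ≠ 0 → ∃ U V K, IsConicFrame U V K (ρ₁ t) ∧ ∀ u, h t u = conic U V K u
  quad : ∀ t t' u u', ρ₁ t ≠ 0 → ρ₁ t' ≠ 0 → ρ₂ u ≠ 0 → ρ₂ u' ≠ 0 →
    (ρ₁ t' * ρ₂ u') • h t u - (ρ₁ t * ρ₂ u') • h t' u + (ρ₁ t * ρ₂ u) • h t' u'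
      - (ρ₁ t' * ρ₂ u) • h t u' = 0
  sphere₁ : ∀ u, ρ₂ u ≠ 0 → ∃ G : LieSpace, form G G = 0 ∧ G.er ≠ 0 ∧
    ∀ t, form G (h t u) = 0 ∧
      ((h t u).e0 ≠ 0 → G.er • n t u = tangentAt (h t u).affinePoint G)
  sphere₂ : ∀ t, ρ₁ t ≠ 0 → ∃ G : LieSpace, form G G = 0 ∧ G.er ≠ 0 ∧
    ∀ u, form G (h t u) = 0 ∧
      ((h t u).e0 ≠ 0 → G.er • n t u = tangentAt (h t u).affinePoint G)

/-! ### Geometry of a curvature net: orthogonality, reflections, separation -/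

namespace CurvatureNet

variable {h : ℝ → ℝ → LieSpace} {n : ℝ → ℝ → E3} {ρ₁ ρ₂ : ℝ → ℝ} {t t' u u' : ℝ}

/-- The conditions are symmetric in the two families, so it suffices to treat sides in the first
direction. -/
lemma swap (N : CurvatureNet h n ρ₁ ρ₂) :
    CurvatureNet (fun u t => h t u) (fun u t => n t u) ρ₂ ρ₁ where
  er u t := N.er t u
  differentiable₁ := N.differentiable₂
  differentiable₂ := N.differentiable₁
  line₁ := N.line₂
  line₂ := N.line₁
  quad u u' t t' hu hu' ht ht' := by
    rw [← N.quad t t' u u' ht ht' hu hu']; module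
  sphere₁ := N.sphere₂
  sphere₂ := N.sphere₁

lemma isPoint (N : CurvatureNet h n ρ₁ ρ₂) (hu : ρ₂ u ≠ 0) (t : ℝ) : (h t u).IsPoint := by
  obtain ⟨U, V, K, H, hh⟩ := N.line₁ u hu
  refine ⟨?_, N.er t u⟩
  rw [hh, H.form_conic]; simp

lemma form_line (N : CurvatureNet h n ρ₁ ρ₂) (hu : ρ₂ u ≠ 0) (t t' : ℝ) :
    form (h t u) (h t' u) = ρ₂ u ^ 2 * (Real.cos (t' - t) - 1) := by
  obtain ⟨U, V, K, H, hh⟩ := N.line₁ u hu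
  rw [hh, hh, H.form_conic]

lemma ne_zero (N : CurvatureNet h n ρ₁ ρ₂) (hu : ρ₂ u ≠ 0) (t : ℝ) : h t u ≠ 0 := by
  intro h0
  have h1 := N.form_line hu t (t + Real.pi)
  rw [h0, form_zero_left, add_sub_cancel_left, Real.cos_pi] at h1
  have : ρ₂ u ^ 2 = 0 := by linarith
  exact hu (pow_eq_zero_iff two_ne_zero |>.1 this)

lemma toPoint_line_eq_iff (N : CurvatureNet h n ρ₁ ρ₂) (hu : ρ₂ u ≠ 0) :
    (h t u).toPoint = (h t' u).toPoint ↔ Real.cos (t' - t) = 1 := by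
  rw [(N.isPoint hu t).toPoint_eq_iff (N.isPoint hu t') (N.ne_zero hu t) (N.ne_zero hu t'),
    N.form_line hu, mul_eq_zero_iff_left (pow_ne_zero 2 hu), sub_eq_zero]

/-- Opposite vertices of a rectangle coincide only if the two others coincide as well. -/
lemma toPoint_diagonal_eq_iff (N : CurvatureNet h n ρ₁ ρ₂) (ht : ρ₁ t ≠ 0) (ht' : ρ₁ t' ≠ 0)
    (hu : ρ₂ u ≠ 0) (hu' : ρ₂ u' ≠ 0) :
    (h t u).toPoint = (h t' u').toPoint ↔ (h t' u).toPoint = (h t u').toPoint := by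
  have hf := (form_eq_of_alternating_sum ((N.isPoint hu t).smul _) ((N.isPoint hu t').smul _)
    ((N.isPoint hu' t').smul _) ((N.isPoint hu' t).smul _) (N.quad t t' u u' ht ht' hu hu')).2.2
  rw [(N.isPoint hu t).toPoint_eq_iff (N.isPoint hu' t') (N.ne_zero hu t) (N.ne_zero hu' t'),
    (N.isPoint hu t').toPoint_eq_iff (N.isPoint hu' t) (N.ne_zero hu t') (N.ne_zero hu' t)]
  simp only [form_smul_left, form_smul_right] at hf
  constructor <;> intro h0
  · simpa [h0, ht, ht', hu, hu'] using hf.symm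
  · simpa [h0, ht, ht', hu, hu'] using hf

/-- The derivative of the homogeneous coordinates along the first coordinate line. -/
def deriv₁ (h : ℝ → ℝ → LieSpace) (t u : ℝ) : LieSpace := deriv (fun s => h s u) t

lemma hasDerivAt (N : CurvatureNet h n ρ₁ ρ₂) (hu : ρ₂ u ≠ 0) (t : ℝ) :
    HasDerivAt (fun s => h s u) (deriv₁ h t u) t := by
  obtain ⟨U, V, K, H, hh⟩ := N.line₁ u hu
  have : (fun s => h s u) = conic U V K := funext hh
  rw [deriv₁, this]
  exact (hasDerivAt_conic U V K t).differentiableAt.hasDerivAt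

lemma exists_deriv₁_eq (N : CurvatureNet h n ρ₁ ρ₂) (hu : ρ₂ u ≠ 0) :
    ∃ U V K, IsConicFrame U V K (ρ₂ u) ∧ (∀ t, h t u = conic U V K t) ∧
      ∀ t, deriv₁ h t u = conicDeriv U V t := by
  obtain ⟨U, V, K, H, hh⟩ := N.line₁ u hu
  refine ⟨U, V, K, H, hh, fun t => ?_⟩
  have : (fun s => h s u) = conic U V K := funext hh
  rw [deriv₁, this, (hasDerivAt_conic U V K t).deriv]

lemma er_deriv₁ (N : CurvatureNet h n ρ₁ ρ₂) (hu : ρ₂ u ≠ 0) : (deriv₁ h t u).er = 0 := by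
  obtain ⟨U, V, K, H, hh, hd⟩ := N.exists_deriv₁_eq hu
  rw [hd]
  exact er_conicDeriv (fun s => by rw [← hh, N.er]) t

lemma form_deriv₁ (N : CurvatureNet h n ρ₁ ρ₂) (hu : ρ₂ u ≠ 0) :
    form (h t u) (deriv₁ h t' u) = -(ρ₂ u ^ 2 * Real.sin (t' - t)) := by
  obtain ⟨U, V, K, H, hh, hd⟩ := N.exists_deriv₁_eq hu
  rw [hh, hd, H.form_conic_conicDeriv]

lemma form_deriv₁_self (N : CurvatureNet h n ρ₁ ρ₂) (hu : ρ₂ u ≠ 0) :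
    form (h t u) (deriv₁ h t u) = 0 := by
  simp [N.form_deriv₁ hu]

lemma form_deriv₁_deriv₁ (N : CurvatureNet h n ρ₁ ρ₂) (hu : ρ₂ u ≠ 0) :
    form (deriv₁ h t u) (deriv₁ h t u) = ρ₂ u ^ 2 := by
  obtain ⟨U, V, K, H, hh, hd⟩ := N.exists_deriv₁_eq hu
  rw [hd, H.form_conicDeriv_self]

lemma deriv₁_add_deriv₁ (N : CurvatureNet h n ρ₁ ρ₂) (hu : ρ₂ u ≠ 0) :
    (1 - Real.cos (t' - t)) • (deriv₁ h t u + deriv₁ h t' u) =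
      Real.sin (t' - t) • (h t' u - h t u) := by
  obtain ⟨U, V, K, H, hh, hd⟩ := N.exists_deriv₁_eq hu
  rw [hd, hd, hh, hh, conicDeriv_add_conicDeriv]

/-- The derivative of the homogeneous coordinates along the second coordinate line. -/
def deriv₂ (h : ℝ → ℝ → LieSpace) (t u : ℝ) : LieSpace := deriv (fun s => h t s) u

/-- Up to multiples of the point itself, the derivatives transversal to a coordinate line are
proportional along this line. -/
lemma exists_smul_deriv₂ (N : CurvatureNet h n ρ₁ ρ₂) (hu : ρ₂ u ≠ 0) :
    ∃ k : ℝ, ∀ t t', ρ₁ t ≠ 0 → ρ₁ t' ≠ 0 →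
      ρ₁ t' • (deriv₂ h t u - k • h t u) = ρ₁ t • (deriv₂ h t' u - k • h t' u) := by
  -- The `u`-derivative of `h / (ρ₁ ρ₂)` is `(deriv₂ h - k • h) / (ρ₁ ρ₂)` with `k` the logarithmic
  -- derivative of `ρ₂`; by `quad` it is the same at `t` and `t'`.
  refine ⟨deriv ρ₂ u / ρ₂ u, fun t t' ht ht' => ?_⟩
  have d1 : HasDerivAt (fun s => h t s) (deriv₂ h t u) u := N.swap.hasDerivAt ht u
  have d2 : HasDerivAt (fun s => h t' s) (deriv₂ h t' u) u := N.swap.hasDerivAt ht' u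
  have d3 := (N.differentiable₂ u).hasDerivAt
  have d4 := (((d1.const_smul (ρ₁ t' * ρ₂ u)).sub (d2.const_smul (ρ₁ t * ρ₂ u))).add
    ((d3.const_mul (ρ₁ t)).smul_const (h t' u))).sub ((d3.const_mul (ρ₁ t')).smul_const (h t u))
  -- `quad` is available only where `ρ₂` is nonzero, an open condition, which suffices for
  -- differentiating at `u`.
  have ev : (fun _ : ℝ => (0 : LieSpace)) =ᶠ[nhds u] _ :=
    (N.differentiable₂.continuous.continuousAt.eventually_ne hu).mono
      fun v hv => (N.quad t t' v u ht ht' hv hu).symm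
  have d5 := (d4.congr_of_eventuallyEq ev).unique (hasDerivAt_const u 0)
  apply smul_right_injective LieSpace hu
  rw [← sub_eq_zero, ← d5]
  match_scalars <;> field_simp

/-- The modified transversal derivative at `t` is a multiple of the one at any nearby `s`, hence
orthogonal to `h s u` for all these `s`; differentiating in `s` gives the claim. -/
lemma form_deriv₁_deriv₂ (N : CurvatureNet h n ρ₁ ρ₂) (ht : ρ₁ t ≠ 0) (hu : ρ₂ u ≠ 0) :
    form (deriv₁ h t u) (deriv₂ h t u) = 0 := by
  obtain ⟨k, hk⟩ := N.exists_smul_deriv₂ hu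
  have d1 := hasDerivAt_form (N.hasDerivAt hu t) (deriv₂ h t u - k • h t u)
  have ev : (fun _ : ℝ => (0 : ℝ)) =ᶠ[nhds t]
      fun s => form (h s u) (deriv₂ h t u - k • h t u) := by
    refine (N.differentiable₁.continuous.continuousAt.eventually_ne ht).mono fun s hs => ?_
    have h1 := congrArg (form (h s u)) (hk t s ht hs)
    have h2 : form (h s u) (deriv₂ h s u) = 0 := N.swap.form_deriv₁_self hs
    rw [form_smul_right, form_smul_right, form_sub_right (h s u) (deriv₂ h s u), h2,
      form_smul_right, (N.isPoint hu s).isotropic] at h1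
    simp only [mul_zero, sub_zero, mul_eq_zero, hs, false_or] at h1
    exact h1.symm
  have d2 := (d1.congr_of_eventuallyEq ev).unique (hasDerivAt_const t 0)
  rw [form_sub_right, form_smul_right, form_comm _ (h t u), N.form_deriv₁_self hu] at d2
  simpa using d2

/-- The unit tangent vector of the first coordinate line. -/
def tangent₁ (h : ℝ → ℝ → LieSpace) (t u : ℝ) : E3 :=
  unitVector (deriv (fun s => (h s u).affinePoint) t)

/-- The unit tangent vector of the second coordinate line. -/
def tangent₂ (h : ℝ → ℝ → LieSpace) (t u : ℝ) : E3 :=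
  unitVector (deriv (fun s => (h t s).affinePoint) u)

lemma deriv_affinePoint (N : CurvatureNet h n ρ₁ ρ₂) (hu : ρ₂ u ≠ 0) (h0 : (h t u).e0 ≠ 0) :
    deriv (fun s => (h s u).affinePoint) t =
      (h t u).e0⁻¹ • tangentAt (h t u).affinePoint (deriv₁ h t u) :=
  (hasDerivAt_affinePoint (N.hasDerivAt hu t) h0).deriv

lemma norm_tangent₁ (N : CurvatureNet h n ρ₁ ρ₂) (hu : ρ₂ u ≠ 0) (h0 : (h t u).e0 ≠ 0) :
    ‖tangent₁ h t u‖ = 1 := by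
  apply norm_unitVector
  rw [N.deriv_affinePoint hu h0]
  refine smul_ne_zero (inv_ne_zero h0) fun h1 => ?_
  have h2 := (N.isPoint hu t).inner_tangentAt h0 (N.form_deriv₁_self hu) (N.form_deriv₁_self hu)
  rw [h1, inner_zero_left, N.form_deriv₁_deriv₁ hu, N.er_deriv₁ hu] at h2
  exact pow_ne_zero 2 hu (by linarith)

lemma inner_tangent₁_tangent₂ (N : CurvatureNet h n ρ₁ ρ₂) (ht : ρ₁ t ≠ 0) (hu : ρ₂ u ≠ 0)
    (h0 : (h t u).e0 ≠ 0) : ⟪tangent₁ h t u, tangent₂ h t u⟫_ℝ = 0 := by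
  have e2 : deriv (fun s => (h t s).affinePoint) u =
      (h t u).e0⁻¹ • tangentAt (h t u).affinePoint (deriv₂ h t u) :=
    N.swap.deriv_affinePoint ht h0
  have e3 : form (h t u) (deriv₂ h t u) = 0 := N.swap.form_deriv₁_self ht
  have h2 := (N.isPoint hu t).inner_tangentAt h0 (N.form_deriv₁_self hu) e3
  rw [N.form_deriv₁_deriv₂ ht hu, N.er_deriv₁ hu, zero_mul, add_zero] at h2
  rw [tangent₁, tangent₂, unitVector, unitVector, N.deriv_affinePoint hu h0, e2]
  simp only [real_inner_smul_left, real_inner_smul_right, h2, mul_zero]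

lemma norm_normal (N : CurvatureNet h n ρ₁ ρ₂) (hu : ρ₂ u ≠ 0) (h0 : (h t u).e0 ≠ 0) :
    ‖n t u‖ = 1 := by
  obtain ⟨G, hG, hGr, hn⟩ := N.sphere₁ u hu
  have h1 : form (h t u) G = 0 := by rw [form_comm]; exact (hn t).1
  have h2 := (N.isPoint hu t).inner_tangentAt h0 h1 h1
  rw [← (hn t).2 h0, real_inner_smul_left, real_inner_smul_right, hG,
    real_inner_self_eq_norm_sq] at h2
  have h3 : ‖n t u‖ ^ 2 = 1 := by
    have : G.er * G.er * (‖n t u‖ ^ 2 - 1) = 0 := by linarith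
    have := (mul_eq_zero.1 this).resolve_left (mul_ne_zero hGr hGr)
    linarith
  exact (pow_eq_one_iff_of_nonneg (norm_nonneg _) two_ne_zero).1 h3

/-- The sphere `G` is constant along the line, so the derivative of the points is orthogonal to it
as well. -/
lemma inner_tangent₁_normal (N : CurvatureNet h n ρ₁ ρ₂) (hu : ρ₂ u ≠ 0)
    (h0 : (h t u).e0 ≠ 0) : ⟪tangent₁ h t u, n t u⟫_ℝ = 0 := by
  obtain ⟨G, hG, hGr, hn⟩ := N.sphere₁ u hu
  have h1 : form (h t u) G = 0 := by rw [form_comm]; exact (hn t).1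
  have d1 := hasDerivAt_form (N.hasDerivAt hu t) G
  have d2 : form (deriv₁ h t u) G = 0 := by
    refine d1.unique ?_
    have : (fun s => form (h s u) G) = fun _ => 0 := by
      funext s; rw [form_comm]; exact (hn s).1
    rw [this]; exact hasDerivAt_const t 0
  have h2 := (N.isPoint hu t).inner_tangentAt h0 (N.form_deriv₁_self hu) h1
  rw [d2, N.er_deriv₁ hu, zero_mul, add_zero, ← (hn t).2 h0, real_inner_smul_right] at h2
  rw [tangent₁, unitVector, N.deriv_affinePoint hu h0, real_inner_smul_left, real_inner_smul_left,
    (mul_eq_zero.1 h2).resolve_left hGr]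
  simp

/-- The product of two points of a line is `-(e0 e0' / 2)` times a squared distance, and also
`ρ₂²(cos - 1) ≤ 0`. So passing to affine points introduces no sign change along a line. -/
lemma e0_mul_e0_pos (N : CurvatureNet h n ρ₁ ρ₂) (hu : ρ₂ u ≠ 0) (h0 : (h t u).e0 ≠ 0)
    (h0' : (h t' u).e0 ≠ 0) (hne : (h t u).affinePoint ≠ (h t' u).affinePoint) :
    0 < (h t u).e0 * (h t' u).e0 := by
  have h1 := N.form_line hu t t'
  rw [(N.isPoint hu t).form_eq_dist (N.isPoint hu t') h0 h0'] at h1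
  have h2 := inner_self_sub_pos hne
  have h3 : ρ₂ u ^ 2 * (Real.cos (t' - t) - 1) ≤ 0 :=
    mul_nonpos_of_nonneg_of_nonpos (sq_nonneg _) (by linarith [Real.cos_le_one (t' - t)])
  refine lt_of_le_of_ne ?_ (mul_ne_zero h0 h0').symm
  by_contra h4
  nlinarith [mul_pos_of_neg_of_neg (not_le.1 h4) (neg_lt_zero.2 h2)]

lemma cos_ne_one (N : CurvatureNet h n ρ₁ ρ₂) (hu : ρ₂ u ≠ 0) (h0 : (h t u).e0 ≠ 0)
    (h0' : (h t' u).e0 ≠ 0) (hne : (h t u).affinePoint ≠ (h t' u).affinePoint) :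
    1 - Real.cos (t' - t) ≠ 0 := by
  intro hc
  have h1 := (N.toPoint_line_eq_iff hu).2 (sub_eq_zero.1 hc).symm
  rw [toPoint_of_e0_ne_zero h0, toPoint_of_e0_ne_zero h0'] at h1
  exact hne (OnePoint.coe_injective h1)

lemma bisectorReflection_tangent₁ (N : CurvatureNet h n ρ₁ ρ₂) (hu : ρ₂ u ≠ 0)
    (h0 : (h t u).e0 ≠ 0) (h0' : (h t' u).e0 ≠ 0)
    (hne : (h t u).affinePoint ≠ (h t' u).affinePoint) :
    bisectorReflection (h t u).affinePoint (h t' u).affinePoint (tangent₁ h t u) =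
      -tangent₁ h t' u := by
  have hc := N.cos_ne_one hu h0 h0' hne
  have hs : deriv₁ h t u = (Real.sin (t' - t) / (1 - Real.cos (t' - t))) • (h t' u - h t u)
      - deriv₁ h t' u := by
    rw [eq_sub_iff_add_eq]
    apply smul_right_injective LieSpace hc
    change (1 - Real.cos (t' - t)) • _ = (1 - Real.cos (t' - t)) • _
    rw [N.deriv₁_add_deriv₁ hu, smul_smul, mul_div_cancel₀ _ hc]
  -- With `κ` minus the cotangent of `(t' - t) / 2`, the vector `deriv₁ h t u - κ • h t u` equals
  -- `-deriv₁ h t' u` up to a multiple of `h t' u`, which `tangentAt` kills.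
  have key := (N.isPoint hu t).bisectorReflection_tangentAt (N.isPoint hu t') h0 h0' hne
    (N.form_deriv₁_self hu) (κ := -(Real.sin (t' - t) / (1 - Real.cos (t' - t)))) (by
      rw [N.form_deriv₁ hu, N.form_line hu, ← neg_sub t' t, Real.sin_neg]; field_simp; ring)
  apply bisectorReflection_unitVector_of_neg hne (k := -((h t u).e0⁻¹ * (h t' u).e0))
  · have := N.e0_mul_e0_pos hu h0 h0' hne
    rw [neg_lt_zero]
    have : (h t u).e0⁻¹ * (h t' u).e0 = (h t u).e0 * (h t' u).e0 * ((h t u).e0⁻¹) ^ 2 := by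
      field_simp
    rw [this]; positivity
  · rw [N.deriv_affinePoint hu h0, N.deriv_affinePoint hu h0', bisectorReflection_smul, key]
    have : deriv₁ h t u - (-(Real.sin (t' - t) / (1 - Real.cos (t' - t)))) • h t u =
        (Real.sin (t' - t) / (1 - Real.cos (t' - t))) • h t' u - deriv₁ h t' u := by
      rw [hs]; module
    rw [this, tangentAt_sub, tangentAt_smul, tangentAt_self h0', smul_smul, neg_mul,
      mul_assoc, mul_inv_cancel₀ h0']
    module

/-- The sphere `G` passes through both points, so `κ = 0`: it is symmetric with respect to their
bisecting plane. -/
lemma bisectorReflection_normal (N : CurvatureNet h n ρ₁ ρ₂) (hu : ρ₂ u ≠ 0)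
    (h0 : (h t u).e0 ≠ 0) (h0' : (h t' u).e0 ≠ 0)
    (hne : (h t u).affinePoint ≠ (h t' u).affinePoint) :
    bisectorReflection (h t u).affinePoint (h t' u).affinePoint (n t u) = n t' u := by
  obtain ⟨G, hG, hGr, hn⟩ := N.sphere₁ u hu
  have key := (N.isPoint hu t).bisectorReflection_tangentAt (N.isPoint hu t') h0 h0' hne
    (by rw [form_comm]; exact (hn t).1) (W := G) (κ := 0)
    (by rw [form_comm, zero_mul]; exact (hn t').1)
  rw [← (hn t).2 h0, zero_smul, sub_zero, ← (hn t').2 h0', bisectorReflection_smul] at key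
  exact smul_right_injective E3 hGr key

/-- The modified transversal derivatives at the two points are proportional, hence orthogonal to
both points, and `κ = 0` again. The ratio of the `ρ₁` is their proportionality factor; the ratio of
the `e0` comes from passing to affine points. -/
lemma bisectorReflection_deriv_affinePoint (N : CurvatureNet h n ρ₁ ρ₂) (ht : ρ₁ t ≠ 0)
    (ht' : ρ₁ t' ≠ 0) (hu : ρ₂ u ≠ 0) (h0 : (h t u).e0 ≠ 0) (h0' : (h t' u).e0 ≠ 0)
    (hne : (h t u).affinePoint ≠ (h t' u).affinePoint) :
    bisectorReflection (h t u).affinePoint (h t' u).affinePoint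
      (deriv (fun s => (h t s).affinePoint) u) =
      (ρ₁ t / ρ₁ t' * ((h t' u).e0 / (h t u).e0)) • deriv (fun s => (h t' s).affinePoint) u := by
  obtain ⟨k, hk⟩ := N.exists_smul_deriv₂ hu
  have f (s) (hs : ρ₁ s ≠ 0) : form (h s u) (deriv₂ h s u - k • h s u) = 0 := by
    have h2 : form (h s u) (deriv₂ h s u) = 0 := N.swap.form_deriv₁_self hs
    rw [form_sub_right, h2, form_smul_right, (N.isPoint hu s).isotropic]; simp
  have e : deriv₂ h t u - k • h t u = (ρ₁ t / ρ₁ t') • (deriv₂ h t' u - k • h t' u) := by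
    rw [div_eq_inv_mul, mul_smul, ← hk t t' ht ht', inv_smul_smul₀ ht']
  have key := (N.isPoint hu t).bisectorReflection_tangentAt (N.isPoint hu t') h0 h0' hne
    (f t ht) (κ := 0) (by rw [e, form_smul_right, f t' ht']; simp)
  rw [zero_smul, sub_zero] at key
  nth_rewrite 2 [e] at key
  simp only [tangentAt_smul, tangentAt_sub, tangentAt_self h0, tangentAt_self h0', smul_zero,
    sub_zero] at key
  have e1 : deriv (fun s => (h t s).affinePoint) u =
      (h t u).e0⁻¹ • tangentAt (h t u).affinePoint (deriv₂ h t u) :=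
    N.swap.deriv_affinePoint ht h0
  have e2 : deriv (fun s => (h t' s).affinePoint) u =
      (h t' u).e0⁻¹ • tangentAt (h t' u).affinePoint (deriv₂ h t' u) :=
    N.swap.deriv_affinePoint ht' h0'
  rw [e1, e2, bisectorReflection_smul, key, smul_smul, smul_smul]
  congr 1
  field_simp

/-- The four vertices of a rectangle are finite and different from each other. -/
structure IsRegularRectangle (h : ℝ → ℝ → LieSpace) (ρ₁ ρ₂ : ℝ → ℝ) (t t' u u' : ℝ) : Prop where
  ρt : ρ₁ t ≠ 0
  ρt' : ρ₁ t' ≠ 0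
  ρu : ρ₂ u ≠ 0
  ρu' : ρ₂ u' ≠ 0
  e0 : (h t u).e0 ≠ 0
  e0₁ : (h t' u).e0 ≠ 0
  e0₂ : (h t u').e0 ≠ 0
  e0₁₂ : (h t' u').e0 ≠ 0
  ne₁ : (h t u).affinePoint ≠ (h t' u).affinePoint
  ne₂ : (h t u).affinePoint ≠ (h t u').affinePoint
  ne₁₂ : (h t u).affinePoint ≠ (h t' u').affinePoint
  ne₁' : (h t u').affinePoint ≠ (h t' u').affinePoint
  ne₂' : (h t' u).affinePoint ≠ (h t' u').affinePoint
  ne₁₂' : (h t' u).affinePoint ≠ (h t u').affinePoint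

lemma IsRegularRectangle.swap (R : IsRegularRectangle h ρ₁ ρ₂ t t' u u') :
    IsRegularRectangle (fun u t => h t u) ρ₂ ρ₁ u u' t t' :=
  ⟨R.ρu, R.ρu', R.ρt, R.ρt', R.e0, R.e0₂, R.e0₁, R.e0₁₂, R.ne₂, R.ne₁, R.ne₁₂, R.ne₂', R.ne₁',
    R.ne₁₂'.symm⟩

lemma IsRegularRectangle.reverse₁ (R : IsRegularRectangle h ρ₁ ρ₂ t t' u u') :
    IsRegularRectangle h ρ₁ ρ₂ t' t u u' :=
  ⟨R.ρt', R.ρt, R.ρu, R.ρu', R.e0₁, R.e0, R.e0₁₂, R.e0₂, R.ne₁.symm, R.ne₂', R.ne₁₂', R.ne₁'.symm,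
    R.ne₂, R.ne₁₂⟩

lemma IsRegularRectangle.reverse₂ (R : IsRegularRectangle h ρ₁ ρ₂ t t' u u') :
    IsRegularRectangle h ρ₁ ρ₂ t t' u' u :=
  R.swap.reverse₁.swap

/-- In the weights of `quad` the factor `ρ₂ u'` occurs squared and the `e0` have equal signs along
the side, so only `ρ₁ t * ρ₁ t'` matters. -/
lemma separated_iff (N : CurvatureNet h n ρ₁ ρ₂) (R : IsRegularRectangle h ρ₁ ρ₂ t t' u u') :
    Separated (h t u).affinePoint (h t' u).affinePoint (h t u').affinePoint
      (h t' u').affinePoint ↔ ρ₁ t * ρ₁ t' < 0 := by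
  have hρ := R.ρt
  have hρ' := R.ρt'
  have hσ := R.ρu
  have hσ' := R.ρu'
  have n1 : ρ₁ t' * ρ₂ u' ≠ 0 := mul_ne_zero hρ' hσ'
  have n2 : ρ₁ t * ρ₂ u' ≠ 0 := mul_ne_zero hρ hσ'
  have n3 : ρ₁ t * ρ₂ u ≠ 0 := mul_ne_zero hρ hσ
  have n4 : ρ₁ t' * ρ₂ u ≠ 0 := mul_ne_zero hρ' hσ
  have key := LieSpace.separated_iff ((N.isPoint hσ t).smul (ρ₁ t' * ρ₂ u'))
    ((N.isPoint hσ t').smul (ρ₁ t * ρ₂ u'))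
    ((N.isPoint hσ' t').smul (ρ₁ t * ρ₂ u)) ((N.isPoint hσ' t).smul (ρ₁ t' * ρ₂ u))
    (mul_ne_zero n1 R.e0) (mul_ne_zero n2 R.e0₁) (mul_ne_zero n3 R.e0₁₂) (mul_ne_zero n4 R.e0₂)
    (by rw [affinePoint_smul n1, affinePoint_smul n2]; exact R.ne₁)
    (by rw [affinePoint_smul n1, affinePoint_smul n3]; exact R.ne₁₂)
    (by rw [affinePoint_smul n1, affinePoint_smul n4]; exact R.ne₂)
    (by rw [affinePoint_smul n2, affinePoint_smul n3]; exact R.ne₂')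
    (by rw [affinePoint_smul n3, affinePoint_smul n4]; exact R.ne₁'.symm)
    (N.quad t t' u u' hρ hρ' hσ hσ')
  rw [affinePoint_smul n1, affinePoint_smul n2, affinePoint_smul n3, affinePoint_smul n4] at key
  rw [key]
  have hp := N.e0_mul_e0_pos hσ R.e0 R.e0₁ R.ne₁
  have : ((ρ₁ t' * ρ₂ u') • h t u).e0 * ((ρ₁ t * ρ₂ u') • h t' u).e0 =
      ρ₁ t * ρ₁ t' * (ρ₂ u' ^ 2 * ((h t u).e0 * (h t' u).e0)) := by
    simp only [e0_smul]; ring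
  rw [this]
  have hq : 0 < ρ₂ u' ^ 2 * ((h t u).e0 * (h t' u).e0) := by positivity
  exact ⟨fun h => neg_of_mul_neg_left h hq.le, fun h => mul_neg_of_neg_of_pos h hq⟩

/-- Up to a positive factor, the ratio in `bisectorReflection_deriv_affinePoint` is `ρ₁ t * ρ₁ t'`,
whose sign also decides separation. -/
lemma bisectorReflection_tangent₂ (N : CurvatureNet h n ρ₁ ρ₂)
    (R : IsRegularRectangle h ρ₁ ρ₂ t t' u u') :
    bisectorReflection (h t u).affinePoint (h t' u).affinePoint (tangent₂ h t u) =
      open Classical in if Separated (h t u).affinePoint (h t' u).affinePoint (h t u').affinePoint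
        (h t' u').affinePoint then -tangent₂ h t' u else tangent₂ h t' u := by
  have key := N.bisectorReflection_deriv_affinePoint R.ρt R.ρt' R.ρu R.e0 R.e0₁ R.ne₁
  have hp := N.e0_mul_e0_pos R.ρu R.e0 R.e0₁ R.ne₁
  have hk : ρ₁ t / ρ₁ t' * ((h t' u).e0 / (h t u).e0) =
      ρ₁ t * ρ₁ t' * ((h t u).e0 * (h t' u).e0 / (ρ₁ t' ^ 2 * (h t u).e0 ^ 2)) := by
    have := R.ρt'
    have := R.e0
    field_simp
  have hq : 0 < (h t u).e0 * (h t' u).e0 / (ρ₁ t' ^ 2 * (h t u).e0 ^ 2) := by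
    have := R.ρt'
    have := R.e0
    positivity
  rw [hk] at key
  split_ifs with hs
  · rw [N.separated_iff R] at hs
    exact bisectorReflection_unitVector_of_neg R.ne₁ (mul_neg_of_neg_of_pos hs hq) key
  · rw [N.separated_iff R] at hs
    exact bisectorReflection_unitVector_of_pos R.ne₁ (mul_pos
      (lt_of_le_of_ne (not_lt.1 hs) (mul_ne_zero R.ρt R.ρt').symm) hq) key

end CurvatureNet

/-! ### Concircularity from linear dependence -/

lemma AffineSubspace.mem_of_weighted_sum_eq_zero {P : AffineSubspace ℝ E3} {a b c d : E3}
    {α β γ δ : ℝ} (ha : a ∈ P) (hb : b ∈ P) (hc : c ∈ P) (hδ : δ ≠ 0) (hs : α + β + γ + δ = 0)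
    (hv : α • a + β • b + γ • c + δ • d = 0) : d ∈ P := by
  have h1 : d = ((-(δ⁻¹ * β)) • (b - a) + (-(δ⁻¹ * γ)) • (c - a)) +ᵥ a := by
    apply smul_right_injective E3 hδ
    change δ • d = δ • (((-(δ⁻¹ * β)) • (b - a) + (-(δ⁻¹ * γ)) • (c - a)) + a)
    have hα : δ = -(α + β + γ) := by linarith
    have h2 : δ • d = -(α • a + β • b + γ • c) := by
      rw [eq_neg_iff_add_eq_zero, ← hv]; module
    rw [h2, smul_add, smul_add, smul_smul, smul_smul, mul_neg, mul_neg,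
      mul_inv_cancel_left₀ hδ, mul_inv_cancel_left₀ hδ, hα]
    module
  rw [h1]
  refine AffineSubspace.vadd_mem_of_mem_direction (Submodule.add_mem _ ?_ ?_) ha
  · exact Submodule.smul_mem _ _ (AffineSubspace.vsub_mem_direction hb ha)
  · exact Submodule.smul_mem _ _ (AffineSubspace.vsub_mem_direction hc ha)

lemma isGeneralizedCircle_line {a b : E3} (h : a ≠ b) :
    IsGeneralizedCircle (insert OnePoint.infty
      ((fun y : E3 => (y : OnePoint E3)) '' {y | y ∈ line[ℝ, a, b]})) := by
  refine Or.inr ⟨_, a, ?_, left_mem_affineSpan_pair ℝ a b, rfl⟩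
  have := (affineIndependent_of_ne ℝ h).finrank_vectorSpan (n := 1) (by simp)
  rwa [direction_affineSpan, ← Matrix.range_cons_cons_empty a b ![]]

/-- The equation of a sphere is linear in `(x, 1, ‖x‖²)`, so `d` satisfies the equation of the
circumsphere of `a`, `b`, `c` and lies in their affine span. If these three are collinear, the
affine part of the relation is enough. -/
lemma concircular_of_weighted_sum {a b c d : E3} {α β γ δ : ℝ} (hab : a ≠ b) (hδ : δ ≠ 0)
    (hs : α + β + γ + δ = 0) (hv : α • a + β • b + γ • c + δ • d = 0)
    (hq : α * ⟪a, a⟫_ℝ + β * ⟪b, b⟫_ℝ + γ * ⟪c, c⟫_ℝ + δ * ⟪d, d⟫_ℝ = 0) :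
    Concircular {(a : OnePoint E3), (b : OnePoint E3), (c : OnePoint E3), (d : OnePoint E3)} := by
  by_cases hcol : Collinear ℝ {a, b, c}
  · refine ⟨_, isGeneralizedCircle_line hab, ?_⟩
    have ha := left_mem_affineSpan_pair ℝ a b
    have hb := right_mem_affineSpan_pair ℝ a b
    have hc : c ∈ line[ℝ, a, b] :=
      hcol.mem_affineSpan_of_mem_of_ne (by simp) (by simp) (by simp) hab
    have hd := AffineSubspace.mem_of_weighted_sum_eq_zero ha hb hc hδ hs hv
    simp only [Set.insert_subset_iff, Set.singleton_subset_iff]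
    exact ⟨Or.inr ⟨a, ha, rfl⟩, Or.inr ⟨b, hb, rfl⟩, Or.inr ⟨c, hc, rfl⟩, Or.inr ⟨d, hd, rfl⟩⟩
  · have hi := affineIndependent_iff_not_collinear_set.2 hcol
    let T : Affine.Simplex ℝ E3 2 := ⟨_, hi⟩
    let P := affineSpan ℝ (Set.range T.points)
    have hP (i) : T.points i ∈ P := subset_affineSpan ℝ _ ⟨i, rfl⟩
    have hd : d ∈ P := AffineSubspace.mem_of_weighted_sum_eq_zero (hP 0) (hP 1) (hP 2) hδ hs hv
    have hr (i) : dist (T.points i) T.circumcenter = T.circumradius :=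
      T.dist_circumcenter_eq_circumradius i
    have hdr : dist d T.circumcenter = T.circumradius := by
      have e (x : E3) : dist x T.circumcenter ^ 2 =
          ⟪x, x⟫_ℝ - 2 * ⟪x, T.circumcenter⟫_ℝ + ⟪T.circumcenter, T.circumcenter⟫_ℝ := by
        rw [dist_eq_norm, ← real_inner_self_eq_norm_sq, real_inner_sub_sub_self]
      have h0 := e a
      have h1 := e b
      have h2 := e c
      have h3 := e d
      rw [show dist a T.circumcenter = _ from hr 0] at h0
      rw [show dist b T.circumcenter = _ from hr 1] at h1
      rw [show dist c T.circumcenter = _ from hr 2] at h2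
      have h4 := congrArg (fun x => ⟪x, T.circumcenter⟫_ℝ) hv
      simp only [inner_add_left, real_inner_smul_left, inner_zero_left] at h4
      rw [← sq_eq_sq₀ dist_nonneg T.circumradius_nonneg]
      apply mul_left_cancel₀ hδ
      linear_combination δ * h3 + hq - 2 * h4 + (α * h0 + β * h1 + γ * h2)
        + (⟪T.circumcenter, T.circumcenter⟫_ℝ - T.circumradius ^ 2) * hs
    refine ⟨_, Or.inl ⟨P, T.circumcenter, T.circumradius, ?_, T.circumcenter_mem_affineSpan,
      T.circumradius_pos, rfl⟩, ?_⟩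
    · rw [direction_affineSpan]
      exact hi.finrank_vectorSpan (by simp)
    · simp only [Set.insert_subset_iff, Set.singleton_subset_iff]
      exact ⟨⟨a, ⟨hP 0, hr 0⟩, rfl⟩, ⟨b, ⟨hP 1, hr 1⟩, rfl⟩, ⟨c, ⟨hP 2, hr 2⟩, rfl⟩,
        ⟨d, ⟨hd, hdr⟩, rfl⟩⟩

namespace LieSpace

variable {A B C D : LieSpace}

/-- The point at infinity has only an `eInf`-component, so the other components form an affine
dependence between `B`, `C`, `D`. -/
lemma concircular_of_infinite (hA : A.IsPoint) (hA0 : A.e0 = 0) (hB0 : B.e0 ≠ 0)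
    (hC0 : C.e0 ≠ 0) (hD0 : D.e0 ≠ 0) (hne : B.toPoint ≠ C.toPoint) (h : A + B + C + D = 0) :
    Concircular {A.toPoint, B.toPoint, C.toPoint, D.toPoint} := by
  have h0 := congrArg e0 h
  have hv := congrArg vec h
  simp only [vec_add, vec_zero, e0_add, e0_zero, hA0, hA.vec_eq_zero hA0, vec_eq hB0, vec_eq hC0,
    vec_eq hD0, zero_add] at h0 hv
  rw [toPoint_of_e0_ne_zero hB0, toPoint_of_e0_ne_zero hC0] at hne
  rw [toPoint_of_e0_eq_zero hA0, toPoint_of_e0_ne_zero hB0, toPoint_of_e0_ne_zero hC0,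
    toPoint_of_e0_ne_zero hD0]
  have hbc : B.affinePoint ≠ C.affinePoint := fun e => hne (congrArg _ e)
  refine ⟨_, isGeneralizedCircle_line hbc, ?_⟩
  have hb := left_mem_affineSpan_pair ℝ B.affinePoint C.affinePoint
  have hc := right_mem_affineSpan_pair ℝ B.affinePoint C.affinePoint
  have hd := AffineSubspace.mem_of_weighted_sum_eq_zero (α := 0) hb hb hc hD0
    (by rw [zero_add]; exact h0) (by rw [zero_smul, zero_add]; exact hv)
  simp only [Set.insert_subset_iff, Set.singleton_subset_iff]
  exact ⟨Or.inl rfl, Or.inr ⟨_, hb, rfl⟩, Or.inr ⟨_, hc, rfl⟩, Or.inr ⟨_, hd, rfl⟩⟩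

/-- Distinct points with linearly dependent coordinate vectors are concircular. -/
lemma concircular_of_sum_eq_zero (hA : A.IsPoint) (hB : B.IsPoint) (hC : C.IsPoint)
    (hD : D.IsPoint) (hne : [A.toPoint, B.toPoint, C.toPoint, D.toPoint].Nodup)
    (h : A + B + C + D = 0) :
    Concircular {A.toPoint, B.toPoint, C.toPoint, D.toPoint} := by
  simp only [List.nodup_cons, List.mem_cons, List.not_mem_nil, or_false, not_or,
    not_false_eq_true, List.nodup_nil, and_true] at hne
  obtain ⟨⟨hab, hac, had⟩, ⟨hbc, hbd⟩, hcd⟩ := hne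
  have fin {X Y : LieSpace} (hXY : X.toPoint ≠ Y.toPoint) (hX : X.e0 = 0) : Y.e0 ≠ 0 := by
    intro hY
    rw [toPoint_of_e0_eq_zero hX, toPoint_of_e0_eq_zero hY] at hXY
    exact hXY rfl
  by_cases hA0 : A.e0 = 0
  · exact concircular_of_infinite hA hA0 (fin hab hA0) (fin hac hA0) (fin had hA0) hbc h
  by_cases hB0 : B.e0 = 0
  · rw [Set.insert_comm]
    exact concircular_of_infinite hB hB0 hA0 (fin hbc hB0) (fin hbd hB0) hac (by rw [← h]; abel)
  by_cases hC0 : C.e0 = 0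
  · rw [Set.insert_comm B.toPoint, Set.insert_comm]
    exact concircular_of_infinite hC hC0 hA0 hB0 (fin hcd hC0) hab (by rw [← h]; abel)
  by_cases hD0 : D.e0 = 0
  · rw [Set.pair_comm C.toPoint, Set.insert_comm B.toPoint, Set.insert_comm]
    exact concircular_of_infinite hD hD0 hA0 hB0 hC0 hab (by rw [← h]; abel)
  have h0 := congrArg e0 h
  have hv := congrArg vec h
  have hi := congrArg eInf h
  simp only [vec_add, vec_zero, e0_add, e0_zero, eInf_add, eInf_zero, vec_eq hA0, vec_eq hB0,
    vec_eq hC0, vec_eq hD0, hA.eInf_eq hA0, hB.eInf_eq hB0, hC.eInf_eq hC0,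
    hD.eInf_eq hD0] at h0 hv hi
  rw [toPoint_of_e0_ne_zero hA0, toPoint_of_e0_ne_zero hB0] at hab
  rw [toPoint_of_e0_ne_zero hA0, toPoint_of_e0_ne_zero hB0, toPoint_of_e0_ne_zero hC0,
    toPoint_of_e0_ne_zero hD0]
  exact concircular_of_weighted_sum (fun e => hab (congrArg _ e)) hD0 h0 hv hi

end LieSpace

lemma CurvatureNet.concircular {h : ℝ → ℝ → LieSpace} {n : ℝ → ℝ → E3} {ρ₁ ρ₂ : ℝ → ℝ}
    {t t' u u' : ℝ} (N : CurvatureNet h n ρ₁ ρ₂) (ht : ρ₁ t ≠ 0) (ht' : ρ₁ t' ≠ 0)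
    (hu : ρ₂ u ≠ 0) (hu' : ρ₂ u' ≠ 0)
    (hne : [(h t u).toPoint, (h t' u).toPoint, (h t' u').toPoint, (h t u').toPoint].Nodup) :
    Concircular {(h t u).toPoint, (h t' u).toPoint, (h t' u').toPoint, (h t u').toPoint} := by
  have n1 : ρ₁ t' * ρ₂ u' ≠ 0 := mul_ne_zero ht' hu'
  have n2 : -(ρ₁ t * ρ₂ u') ≠ 0 := neg_ne_zero.2 (mul_ne_zero ht hu')
  have n3 : ρ₁ t * ρ₂ u ≠ 0 := mul_ne_zero ht hu
  have n4 : -(ρ₁ t' * ρ₂ u) ≠ 0 := neg_ne_zero.2 (mul_ne_zero ht' hu)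
  rw [← toPoint_smul n1 (h t u), ← toPoint_smul n2 (h t' u), ← toPoint_smul n3 (h t' u'),
    ← toPoint_smul n4 (h t u')] at hne ⊢
  refine concircular_of_sum_eq_zero ((N.isPoint hu t).smul _) ((N.isPoint hu t').smul _)
    ((N.isPoint hu' t').smul _) ((N.isPoint hu' t).smul _) hne ?_
  rw [← N.quad t t' u u' ht ht' hu hu']
  module

/-! ### Contact with a fixed sphere -/

namespace LieSpace

variable {y z U V K : LieSpace} {c : ℝ}

@[simp] lemma er_contactVec (y z : LieSpace) : (contactVec y z).er = 0 := by
  simp only [contactVec, er_sub, er_smul]; ring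

/-- Modulo the isotropic `y`, which is orthogonal to everything involved, `contactVec y` is
multiplication by `-y.er`. Conics of spheres touching `y` thus become conics of points, scaled by
`y.er`. -/
lemma form_contactVec_right {a b : LieSpace} (hy : form y y = 0) (ha : form y a = 0)
    (hb : form y b = 0) :
    form (contactVec y a) (contactVec y b) = y.er ^ 2 * form a b := by
  simp only [contactVec, form_sub_left, form_sub_right, form_smul_left, form_smul_right, hy, ha,
    hb, form_comm a y]
  ring

lemma contactVec_swap (y z : LieSpace) : contactVec y z = (-1 : ℝ) • contactVec z y := by
  simp only [contactVec]; module

lemma contactVec_conic (y U V K : LieSpace) (t : ℝ) :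
    contactVec y (conic U V K t) = conic (contactVec y U) (contactVec y V) (contactVec y K) t := by
  simp only [contactVec, conic, er_add, er_smul]; module

lemma IsConicFrame.contactVec (H : IsConicFrame U V K c) (hy : form y y = 0) (hU : form y U = 0)
    (hV : form y V = 0) (hK : form y K = 0) :
    IsConicFrame (contactVec y U) (contactVec y V) (contactVec y K) (y.er * c) where
  UU := by rw [form_contactVec_right hy hU hU, H.UU]; ring
  VV := by rw [form_contactVec_right hy hV hV, H.VV]; ring
  KK := by rw [form_contactVec_right hy hK hK, H.KK]; ring
  UV := by rw [form_contactVec_right hy hU hV, H.UV, mul_zero]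
  UK := by rw [form_contactVec_right hy hU hK, H.UK, mul_zero]
  VK := by rw [form_contactVec_right hy hV hK, H.VK, mul_zero]

lemma IsConicFrame.smul (H : IsConicFrame U V K c) (a : ℝ) :
    IsConicFrame (a • U) (a • V) (a • K) (a * c) where
  UU := by rw [form_smul_left, form_smul_right, H.UU]; ring
  VV := by rw [form_smul_left, form_smul_right, H.VV]; ring
  KK := by rw [form_smul_left, form_smul_right, H.KK]; ring
  UV := by rw [form_smul_left, form_smul_right, H.UV]; ring
  UK := by rw [form_smul_left, form_smul_right, H.UK]; ring
  VK := by rw [form_smul_left, form_smul_right, H.VK]; ring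

lemma IsConicFrame.neg_scale (H : IsConicFrame U V K (-1 * c)) : IsConicFrame U V K c := by
  obtain ⟨h1, h2, h3, h4, h5, h6⟩ := H
  have e : (-1 * c) ^ 2 = c ^ 2 := by ring
  rw [e] at h1 h2 h3
  exact ⟨h1, h2, h3, h4, h5, h6⟩

lemma form_contactVec_left_self (hy : form y y = 0) (hz : form y z = 0) :
    form y (contactVec y z) = 0 := by
  simp [contactVec, hy, hz]

lemma form_contactVec_right_self (hy : form z z = 0) (hz : form y z = 0) :
    form z (contactVec y z) = 0 := by
  simp [contactVec, hy, hz, form_comm z y]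

end LieSpace

lemma eq_of_cos_sub_eq_one {a t : ℝ} (h1 : a ≤ t) (h2 : t < a + 2 * Real.pi)
    (h : Real.cos (t - a) = 1) : t = a := by
  have := (Real.cos_eq_one_iff_of_lt_of_lt (by linarith [Real.pi_pos]) (by linarith)).1 h
  linarith

/-- The zeros of `ρ₁` and `ρ₂` are the parameters of singular points, and `f` is determined
near its first vertex by its boundary arcs. -/
structure CyclidicSurface.IsRegularNet (C : CyclidicSurface) (ρ₁ ρ₂ : ℝ → ℝ) : Prop where
  net : CurvatureNet C.hat C.normal ρ₁ ρ₂
  collapse₁ : ∀ t, ρ₁ t = 0 → ∀ u u', C.point t u = C.point t u'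
  collapse₂ : ∀ u, ρ₂ u = 0 → ∀ t t', C.point t u = C.point t' u
  start : ∀ f g : CyclidicPatch, f.surface = C → g.IsSubpatch f → ρ₁ f.a₁ ≠ 0 → ρ₂ f.a₂ ≠ 0 →
    g.vertex false false = f.vertex false false → g.arc₁ ⊆ f.arc₁ → g.arc₂ ⊆ f.arc₂ →
    g.a₁ = f.a₁ ∧ g.a₂ = f.a₂
  opposite : ¬ C.IsSpherical → ∀ t t' u u', ρ₁ t ≠ 0 → ρ₁ t' ≠ 0 → ρ₂ u ≠ 0 → ρ₂ u' ≠ 0 →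
    C.point t' u = C.point t u' → Real.cos (t' - t) = 1

/-! ### Dupin cyclides as curvature nets -/

namespace DupinCyclide

variable (D : DupinCyclide)

lemma isConicFrame (i : Fin 2) : IsConicFrame (D.frame i 0) (D.frame i 1) (D.frame i 2) 1 where
  UU := by simp [D.gram]
  VV := by simp [D.gram]
  KK := by simp [D.gram]
  UV := by simp [D.gram]
  UK := by simp [D.gram]
  VK := by simp [D.gram]

lemma sphere_eq_conic (i : Fin 2) (t : ℝ) :
    D.sphere i t = conic (D.frame i 0) (D.frame i 1) (D.frame i 2) t := rfl

lemma form_sphere (i : Fin 2) (t t' : ℝ) :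
    form (D.sphere i t) (D.sphere i t') = Real.cos (t' - t) - 1 := by
  rw [sphere_eq_conic, sphere_eq_conic, (D.isConicFrame i).form_conic]; ring

lemma form_sphere_self (i : Fin 2) (t : ℝ) : form (D.sphere i t) (D.sphere i t) = 0 := by
  simp [D.form_sphere]

lemma form_sphere_frame_of_ne {i j : Fin 2} (hij : i ≠ j) (t : ℝ) (k : Fin 3) :
    form (D.sphere i t) (D.frame j k) = 0 := by
  simp [sphere, D.gram, hij]

lemma form_sphere_frame_two (i : Fin 2) (t : ℝ) : form (D.sphere i t) (D.frame i 2) = -1 := by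
  simp [sphere, D.gram]

lemma form_sphere_sphere {i j : Fin 2} (hij : i ≠ j) (t u : ℝ) :
    form (D.sphere i t) (D.sphere j u) = 0 := by
  simp only [D.sphere_eq_conic j, conic, form_add_right, form_smul_right,
    D.form_sphere_frame_of_ne hij]
  ring

lemma sphere_ne_zero (i : Fin 2) (t : ℝ) : D.sphere i t ≠ 0 := by
  intro h
  have := D.form_sphere_frame_two i t
  rw [h] at this
  simp at this

/-- Two points in contact coincide, so an isotropic line would lie in both orthogonal subspaces.
Hence the contact vector never vanishes. -/
lemma er_ne_zero_of_er_eq_zero {i j : Fin 2} (hij : i ≠ j) {t u : ℝ} (h : (D.sphere i t).er = 0) :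
    (D.sphere j u).er ≠ 0 := by
  intro h'
  obtain ⟨a, -, hz⟩ := IsPoint.exists_smul_of_form_eq_zero ⟨D.form_sphere_self i t, h⟩
    ⟨D.form_sphere_self j u, h'⟩ (D.sphere_ne_zero i t) (D.sphere_ne_zero j u)
    (D.form_sphere_sphere hij t u)
  have h2 := D.form_sphere_frame_two j u
  rw [hz, form_smul_left, D.form_sphere_frame_of_ne hij] at h2
  simp at h2

lemma form_contactVec_frame (t u : ℝ) :
    form (contactVec (D.sphere 0 t) (D.sphere 1 u)) (D.frame 0 2) = -(D.sphere 1 u).er ∧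
      form (contactVec (D.sphere 0 t) (D.sphere 1 u)) (D.frame 1 2) = (D.sphere 0 t).er := by
  simp [contactVec, D.form_sphere_frame_two, D.form_sphere_frame_of_ne]

lemma isPoint_contactVec (t u : ℝ) : (contactVec (D.sphere 0 t) (D.sphere 1 u)).IsPoint := by
  refine ⟨?_, er_contactVec _ _⟩
  have h := D.form_sphere_sphere zero_ne_one t u
  rw [form_contactVec_right (D.form_sphere_self 0 t) h h, D.form_sphere_self, mul_zero]

lemma contactVec_ne_zero (t u : ℝ) : contactVec (D.sphere 0 t) (D.sphere 1 u) ≠ 0 := by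
  intro h
  obtain ⟨h1, h2⟩ := D.form_contactVec_frame t u
  rw [h, form_zero_left] at h1 h2
  exact D.er_ne_zero_of_er_eq_zero zero_ne_one h2.symm (neg_eq_zero.1 h1.symm)

/-- Coinciding points have proportional contact vectors. The sphere at `t` is orthogonal to the
first vector, hence to the second; that product is the `er` of the sphere at `u'` times `cos (t' -
t) - 1`. Products with `frame 0 2` and `frame 1 2` show that the `er` at the second pair of
parameters are nonzero too. -/
lemma cos_sub_eq_one {t t' u u' : ℝ} (ht : (D.sphere 0 t).er ≠ 0) (hu : (D.sphere 1 u).er ≠ 0)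
    (h : (contactVec (D.sphere 0 t) (D.sphere 1 u)).toPoint =
      (contactVec (D.sphere 0 t') (D.sphere 1 u')).toPoint) :
    Real.cos (t' - t) = 1 ∧ Real.cos (u' - u) = 1 := by
  rw [(D.isPoint_contactVec t u).toPoint_eq_iff (D.isPoint_contactVec t' u')
    (D.contactVec_ne_zero t u) (D.contactVec_ne_zero t' u')] at h
  obtain ⟨a, ha, hz⟩ := (D.isPoint_contactVec t u).exists_smul_of_form_eq_zero
    (D.isPoint_contactVec t' u') (D.contactVec_ne_zero t u) (D.contactVec_ne_zero t' u') h
  obtain ⟨h1, h2⟩ := D.form_contactVec_frame t u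
  obtain ⟨h1', h2'⟩ := D.form_contactVec_frame t' u'
  rw [hz, form_smul_left, h1] at h1'
  rw [hz, form_smul_left, h2] at h2'
  have hu' : (D.sphere 1 u').er ≠ 0 := by
    rw [show (D.sphere 1 u').er = a * (D.sphere 1 u).er by linarith]
    exact mul_ne_zero ha hu
  have ht' : (D.sphere 0 t').er ≠ 0 := by rw [← h2']; exact mul_ne_zero ha ht
  have k1 := congrArg (form (D.sphere 0 t)) hz
  have k2 := congrArg (form (D.sphere 1 u)) hz
  simp only [contactVec, form_sub_right, form_smul_right, D.form_sphere,
    D.form_sphere_sphere zero_ne_one, D.form_sphere_sphere one_ne_zero, sub_self, Real.cos_zero,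
    mul_zero, sub_zero, zero_sub, neg_eq_zero, mul_eq_zero, hu', ht', false_or] at k1 k2
  exact ⟨by linarith, by linarith⟩

lemma hat_eq (t u : ℝ) :
    (CyclidicSurface.dupin D).hat t u = contactVec (D.sphere 0 t) (D.sphere 1 u) := rfl

lemma differentiable_er (i : Fin 2) : Differentiable ℝ fun t => (D.sphere i t).er := fun t =>
  (hasDerivAt_er (hasDerivAt_conic _ _ _ t)).differentiableAt

lemma curvatureNet : CurvatureNet (CyclidicSurface.dupin D).hat (CyclidicSurface.dupin D).normal
    (fun t => (D.sphere 0 t).er) (fun u => (D.sphere 1 u).er) where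
  er t u := er_contactVec _ _
  differentiable₁ := D.differentiable_er 0
  differentiable₂ := D.differentiable_er 1
  line₁ u _ := by
    have H := (((D.isConicFrame 0).contactVec (D.form_sphere_self 1 u)
      (D.form_sphere_frame_of_ne one_ne_zero u 0) (D.form_sphere_frame_of_ne one_ne_zero u 1)
      (D.form_sphere_frame_of_ne one_ne_zero u 2)).smul (-1)).neg_scale
    rw [mul_one] at H
    refine ⟨_, _, _, H, fun t => ?_⟩
    rw [hat_eq, contactVec_swap, D.sphere_eq_conic 0, contactVec_conic]
    simp only [conic]; module
  line₂ t _ := by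
    have H := (D.isConicFrame 1).contactVec (D.form_sphere_self 0 t)
      (D.form_sphere_frame_of_ne zero_ne_one t 0) (D.form_sphere_frame_of_ne zero_ne_one t 1)
      (D.form_sphere_frame_of_ne zero_ne_one t 2)
    rw [mul_one] at H
    refine ⟨_, _, _, H, fun u => ?_⟩
    rw [hat_eq, D.sphere_eq_conic 1, contactVec_conic]
  quad t t' u u' _ _ _ _ := by
    simp only [hat_eq, contactVec]; module
  sphere₁ u hu := ⟨D.sphere 1 u, D.form_sphere_self 1 u, hu, fun t =>
    ⟨form_contactVec_right_self (D.form_sphere_self 1 u) (D.form_sphere_sphere zero_ne_one t u),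
      fun h0 => tangentAt_contact_right h0⟩⟩
  sphere₂ t ht := ⟨D.sphere 0 t, D.form_sphere_self 0 t, ht, fun u =>
    ⟨form_contactVec_left_self (D.form_sphere_self 0 t) (D.form_sphere_sphere zero_ne_one t u),
      fun h0 => tangentAt_contact_left h0⟩⟩

lemma isRegularNet : (CyclidicSurface.dupin D).IsRegularNet
    (fun t => (D.sphere 0 t).er) (fun u => (D.sphere 1 u).er) where
  net := D.curvatureNet
  collapse₁ t ht u u' := by
    have e (v : ℝ) : (CyclidicSurface.dupin D).point t v = (D.sphere 0 t).toPoint := by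
      rw [CyclidicSurface.point, hat_eq, contactVec, ht, zero_smul, sub_zero,
        toPoint_smul (D.er_ne_zero_of_er_eq_zero zero_ne_one ht)]
    rw [e, e]
  collapse₂ u hu t t' := by
    have e (v : ℝ) : (CyclidicSurface.dupin D).point v u = (D.sphere 1 u).toPoint := by
      rw [CyclidicSurface.point, hat_eq, contactVec, hu, zero_smul, zero_sub, ← neg_smul,
        toPoint_smul (neg_ne_zero.2 (D.er_ne_zero_of_er_eq_zero one_ne_zero hu))]
    rw [e, e]
  start f g hf hg ht hu hv _ _ := by
    obtain ⟨hs, h1, h2⟩ := hg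
    rw [Set.Icc_subset_Icc_iff g.lt₁.le] at h1
    rw [Set.Icc_subset_Icc_iff g.lt₂.le] at h2
    have hv' : (CyclidicSurface.dupin D).point g.a₁ g.a₂ =
        (CyclidicSurface.dupin D).point f.a₁ f.a₂ := by
      rw [← hf]; nth_rewrite 1 [← hs]; exact hv
    obtain ⟨k1, k2⟩ := D.cos_sub_eq_one ht hu hv'.symm
    exact ⟨eq_of_cos_sub_eq_one h1.1 (by linarith [g.lt₁, f.proper₁]) k1,
      eq_of_cos_sub_eq_one h2.1 (by linarith [g.lt₂, f.proper₂]) k2⟩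
  opposite _ t t' u u' ht _ _ hu' h := (D.cos_sub_eq_one ht hu' h.symm).1

end DupinCyclide

namespace CyclidicPatch

lemma bounds_of_isSubpatch {f g : CyclidicPatch} (h : g.IsSubpatch f) :
    f.a₁ ≤ g.a₁ ∧ g.b₁ ≤ f.b₁ ∧ f.a₂ ≤ g.a₂ ∧ g.b₂ ≤ f.b₂ := by
  obtain ⟨-, h1, h2⟩ := h
  rw [Set.Icc_subset_Icc_iff g.lt₁.le] at h1
  rw [Set.Icc_subset_Icc_iff g.lt₂.le] at h2
  exact ⟨h1.1, h1.2, h2.1, h2.2⟩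

end CyclidicPatch

lemma CurvatureNet.cos_sub_eq_one {C : CyclidicSurface} {ρ₁ ρ₂ : ℝ → ℝ}
    (N : CurvatureNet C.hat C.normal ρ₁ ρ₂) {t t' u : ℝ} (hu : ρ₂ u ≠ 0)
    (h : C.point t u = C.point t' u) : Real.cos (t' - t) = 1 :=
  (N.toPoint_line_eq_iff hu).1 h

/-! ### Spheres with meridians and parallels -/

namespace FramedSphere

variable (S : FramedSphere)

/-- Points of a sphere in coordinates that are, up to the factor `c₁ c₂`, sums of functions of
one variable, and whose coordinate lines are conics. -/
lemma curvatureNet {w : ℝ → ℝ → LieSpace} {c₁ c₂ : ℝ → ℝ} (hs : ∀ t u, form S.s (w t u) = 0)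
    (d₁ : Differentiable ℝ c₁) (d₂ : Differentiable ℝ c₂)
    (l₁ : ∀ u, c₂ u ≠ 0 → ∃ U V K, IsConicFrame U V K (c₂ u) ∧ (form S.s U = 0 ∧ form S.s V = 0 ∧
      form S.s K = 0) ∧ ∀ t, w t u = conic U V K t)
    (l₂ : ∀ t, c₁ t ≠ 0 → ∃ U V K, IsConicFrame U V K (c₁ t) ∧ (form S.s U = 0 ∧ form S.s V = 0 ∧
      form S.s K = 0) ∧ ∀ u, w t u = conic U V K u)
    (q : ∀ t t' u u', c₁ t ≠ 0 → c₁ t' ≠ 0 → c₂ u ≠ 0 → c₂ u' ≠ 0 →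
      (c₁ t' * c₂ u') • w t u - (c₁ t * c₂ u') • w t' u + (c₁ t * c₂ u) • w t' u'
        - (c₁ t' * c₂ u) • w t u' = 0) :
    CurvatureNet (fun t u => contactVec S.s (w t u)) (fun t u => contactNormal S.s (w t u))
      (fun t => S.s.er * c₁ t) (fun u => S.s.er * c₂ u) where
  er t u := er_contactVec _ _
  differentiable₁ := d₁.const_mul _
  differentiable₂ := d₂.const_mul _
  line₁ u hu := by
    obtain ⟨U, V, K, H, ⟨hU, hV, hK⟩, hw⟩ := l₁ u (right_ne_zero_of_mul hu)
    exact ⟨_, _, _, H.contactVec S.isotropic hU hV hK, fun t => by rw [hw, contactVec_conic]⟩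
  line₂ t ht := by
    obtain ⟨U, V, K, H, ⟨hU, hV, hK⟩, hw⟩ := l₂ t (right_ne_zero_of_mul ht)
    exact ⟨_, _, _, H.contactVec S.isotropic hU hV hK, fun u => by rw [hw, contactVec_conic]⟩
  quad t t' u u' ht ht' hu hu' := by
    have h := congrArg (contactVec S.s) (q t t' u u' (right_ne_zero_of_mul ht)
      (right_ne_zero_of_mul ht') (right_ne_zero_of_mul hu) (right_ne_zero_of_mul hu'))
    have h' : contactVec S.s 0 = 0 := by simp [contactVec]
    rw [h'] at h
    rw [← smul_zero (S.s.er ^ 2), ← h]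
    simp only [contactVec, er_add, er_sub, er_smul]
    module
  sphere₁ u _ := ⟨S.s, S.isotropic, S.not_point, fun t =>
    ⟨form_contactVec_left_self S.isotropic (hs t u), fun h0 => tangentAt_contact_left h0⟩⟩
  sphere₂ t _ := ⟨S.s, S.isotropic, S.not_point, fun u =>
    ⟨form_contactVec_left_self S.isotropic (hs t u), fun h0 => tangentAt_contact_left h0⟩⟩

lemma form_eq_zero_of_toPoint_eq {w w' : LieSpace} (h : form S.s w = 0) (h' : form S.s w' = 0)
    (hw : form w w = 0) (hw' : form w' w' = 0)
    (e : (contactVec S.s w).toPoint = (contactVec S.s w').toPoint) : form w w' = 0 := by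
  have p {w : LieSpace} (h : form S.s w = 0) (hw : form w w = 0) : (contactVec S.s w).IsPoint :=
    ⟨by rw [form_contactVec_right S.isotropic h h, hw, mul_zero], er_contactVec _ _⟩
  have := (p h hw).form_eq_zero_of_toPoint_eq (p h' hw') e
  rw [form_contactVec_right S.isotropic h h'] at this
  exact (mul_eq_zero.1 this).resolve_left (pow_ne_zero 2 S.not_point)

lemma form_s_geographic (φ θ : ℝ) : form S.s (S.geographic φ θ) = 0 := by
  simp [geographic, S.incident]

lemma form_geographic (φ θ φ' θ' : ℝ) : form (S.geographic φ θ) (S.geographic φ' θ') =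
    Real.cos φ * Real.cos φ' * Real.cos (θ' - θ) + Real.sin φ * Real.sin φ' - 1 := by
  simp [geographic, S.gram, Real.cos_sub]
  ring

lemma form_geographic_self (φ θ : ℝ) : form (S.geographic φ θ) (S.geographic φ θ) = 0 := by
  rw [form_geographic, sub_self, Real.cos_zero]
  linear_combination Real.sin_sq_add_cos_sq φ

/-- Division by `cos φ` separates the variables: `cos θ w₀ + sin θ w₁` plus `tan φ w₂ + w₃ / cos φ`.
-/
lemma curvatureNet_geographic : CurvatureNet (fun t u => contactVec S.s (S.geographic t u))
    (fun t u => contactNormal S.s (S.geographic t u))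
    (fun t => S.s.er * Real.cos t) (fun _ => S.s.er * 1) := by
  refine S.curvatureNet (c₂ := fun _ => 1) S.form_s_geographic Real.differentiable_cos
    (differentiable_const _) (fun u _ => ?_) (fun t _ => ?_) (fun t t' u u' _ _ _ _ => ?_)
  · refine ⟨Real.cos u • S.w 0 + Real.sin u • S.w 1, S.w 2, S.w 3, ?_, ?_, fun t => rfl⟩
    · constructor <;> simp [S.gram]
      linear_combination Real.sin_sq_add_cos_sq u
    · simp [S.incident]
  · refine ⟨Real.cos t • S.w 0, Real.cos t • S.w 1, Real.sin t • S.w 2 + S.w 3, ?_, ?_,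
      fun u => ?_⟩
    · constructor <;> simp [S.gram]
      · ring
      · ring
      · linear_combination Real.sin_sq_add_cos_sq t
    · simp [S.incident]
    · simp only [geographic, conic]; module
  · simp only [geographic]; module

lemma geographic_eq_of_cos_eq_zero {φ : ℝ} (h : Real.cos φ = 0) (θ θ' : ℝ) :
    S.geographic φ θ = S.geographic φ θ' := by
  simp [geographic, h]

/-- The geographic coordinates cover the sphere twice. -/
lemma cos_eq_of_geographic_eq {φ θ φ' θ' : ℝ} (h : Real.cos φ ≠ 0)
    (e : (contactVec S.s (S.geographic φ θ)).toPoint =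
      (contactVec S.s (S.geographic φ' θ')).toPoint) :
    (Real.cos (φ' - φ) = 1 ∧ Real.cos (θ' - θ) = 1) ∨
      (Real.cos (φ' + φ) = -1 ∧ Real.cos (θ' - θ) = -1) := by
  have hf := S.form_eq_zero_of_toPoint_eq (S.form_s_geographic φ θ) (S.form_s_geographic φ' θ')
    (S.form_geographic_self φ θ) (S.form_geographic_self φ' θ') e
  rw [form_geographic] at hf
  rw [Real.cos_sub φ', Real.cos_add φ']
  have h1 := Real.sin_sq_add_cos_sq φ
  have h2 := Real.sin_sq_add_cos_sq φ'
  have hc := Real.cos_sq_le_one (θ' - θ)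
  generalize Real.cos (θ' - θ) = c at *
  generalize Real.cos φ = x at *
  generalize Real.sin φ = y at *
  generalize Real.cos φ' = x' at *
  generalize Real.sin φ' = y' at *
  -- Completing squares turns the incidence equation into a sum of squares equal to a nonpositive
  -- number, so every term vanishes.
  have k : (c * x' - x) ^ 2 + (y' - y) ^ 2 = -(1 - c ^ 2) * x' ^ 2 := by
    linear_combination h1 + h2 - 2 * hf
  have k' : 0 ≤ (1 - c ^ 2) * x' ^ 2 := mul_nonneg (by linarith) (sq_nonneg _)
  have n1 := sq_nonneg (c * x' - x)
  have n2 := sq_nonneg (y' - y)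
  have e1 : c * x' - x = 0 := (pow_eq_zero_iff two_ne_zero).1 (by linarith)
  have e2 : y' - y = 0 := (pow_eq_zero_iff two_ne_zero).1 (by linarith)
  have hx' : x' ≠ 0 := by
    rintro rfl
    exact h (by linarith)
  have hc1 : (1 - c ^ 2) * x' ^ 2 = 0 := by linarith
  have hc2 := (mul_eq_zero.1 hc1).resolve_right (pow_ne_zero 2 hx')
  have hy : y' = y := by linarith
  have hx : x = c * x' := by linarith
  rcases eq_or_eq_neg_of_sq_eq_sq c 1 (by linarith) with rfl | rfl
  · left
    exact ⟨by rw [hx, ← hy]; linarith, rfl⟩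
  · right
    exact ⟨by rw [hx, ← hy]; linarith, rfl⟩

/-- A meridian arc on the antipodal meridian runs in the other direction, hence does not stay in
a given arc when it has the same starting point. -/
lemma geographic_start {a₁ b₁ a₂ b₂ g₁ g₁' g₂ : ℝ} (ha : Real.cos a₁ ≠ 0) (hb₁ : b₁ < a₁ + 2 * Real.pi)
    (hb₂ : b₂ < a₂ + 2 * Real.pi) (hg₁ : a₁ ≤ g₁) (hgg : g₁ < g₁') (hg₁' : g₁' ≤ b₁)
    (hg₂ : a₂ ≤ g₂) (hg₂' : g₂ ≤ b₂)
    (e : (contactVec S.s (S.geographic g₁ g₂)).toPoint =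
      (contactVec S.s (S.geographic a₁ a₂)).toPoint)
    (harc : ∀ t ∈ Set.Icc g₁ g₁', ∃ s ∈ Set.Icc a₁ b₁,
      (contactVec S.s (S.geographic s a₂)).toPoint =
        (contactVec S.s (S.geographic t g₂)).toPoint) : g₁ = a₁ ∧ g₂ = a₂ := by
  rcases S.cos_eq_of_geographic_eq ha e.symm with ⟨h1, h2⟩ | ⟨h1, h2⟩
  · exact ⟨eq_of_cos_sub_eq_one hg₁ (by linarith) h1, eq_of_cos_sub_eq_one hg₂ (by linarith) h2⟩
  exfalso
  -- `ε` is small enough for `g₁ + ε` to stay in the subarc, and smaller than the part of the period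
  -- that the arc leaves out.
  obtain ⟨ε, hε, hε'⟩ := exists_between (show 0 < min (g₁' - g₁) (a₁ + 2 * Real.pi - b₁) from
    lt_min (by linarith) (by linarith))
  rw [lt_min_iff] at hε'
  obtain ⟨s, hs, hst⟩ := harc (g₁ + ε) ⟨by linarith, by linarith⟩
  have hf := S.form_eq_zero_of_toPoint_eq (S.form_s_geographic _ _) (S.form_s_geographic _ _)
    (S.form_geographic_self _ _) (S.form_geographic_self _ _) hst
  rw [form_geographic, h2] at hf
  have h3 : Real.cos (s + (g₁ + ε)) = -1 := by rw [Real.cos_add]; linarith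
  have h4 : Real.sin (g₁ + a₁) = 0 := by
    have := Real.sin_sq_add_cos_sq (g₁ + a₁)
    rw [h1] at this
    exact (pow_eq_zero_iff two_ne_zero).1 (by linarith)
  -- The point at `g₁ + ε` on the antipodal meridian has the parameter `a₁ - ε` modulo `2π` on the
  -- given one, outside the arc.
  have h5 : Real.cos (s + ε - a₁) = 1 := by
    rw [show s + ε - a₁ = s + (g₁ + ε) - (g₁ + a₁) by ring, Real.cos_sub, h3, h1, h4]; ring
  have h6 := (Real.cos_eq_one_iff_of_lt_of_lt (by linarith [hs.1, Real.pi_pos])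
    (by linarith [hs.2])).1 h5
  linarith [hs.1]

lemma isRegularNet_geographic : (CyclidicSurface.geographic S).IsRegularNet
    (fun t => S.s.er * Real.cos t) (fun _ => S.s.er * 1) where
  net := S.curvatureNet_geographic
  collapse₁ t ht u u' := by
    have h := (mul_eq_zero.1 ht).resolve_left S.not_point
    have := S.geographic_eq_of_cos_eq_zero h u u'
    exact congrArg (fun w => (contactVec S.s w).toPoint) this
  collapse₂ u hu := absurd ((mul_eq_zero.1 hu).resolve_left S.not_point) one_ne_zero
  start f g hf hg ht hu hv h₁ _ := by
    obtain ⟨k1, k2, k3, k4⟩ := CyclidicPatch.bounds_of_isSubpatch hg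
    have hgs := hg.1.trans hf
    simp only [CyclidicPatch.vertex, CyclidicPatch.arc₁, CyclidicPatch.end₁, CyclidicPatch.end₂,
      hf, hgs] at hv h₁
    exact S.geographic_start (right_ne_zero_of_mul ht) f.proper₁ f.proper₂ k1 g.lt₁ k2 k3
      (g.lt₂.le.trans k4) hv fun t ht => h₁ ⟨t, ht, rfl⟩
  opposite h := absurd trivial h

lemma isRegularNet_geographicSwap : (CyclidicSurface.geographicSwap S).IsRegularNet
    (fun _ => S.s.er * 1) (fun t => S.s.er * Real.cos t) where
  net := S.curvatureNet_geographic.swap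
  collapse₁ u hu := absurd ((mul_eq_zero.1 hu).resolve_left S.not_point) one_ne_zero
  collapse₂ t ht u u' := by
    have h := (mul_eq_zero.1 ht).resolve_left S.not_point
    have := S.geographic_eq_of_cos_eq_zero h u u'
    exact congrArg (fun w => (contactVec S.s w).toPoint) this
  start f g hf hg ht hu hv _ h₂ := by
    obtain ⟨k1, k2, k3, k4⟩ := CyclidicPatch.bounds_of_isSubpatch hg
    have hgs := hg.1.trans hf
    simp only [CyclidicPatch.vertex, CyclidicPatch.arc₂, CyclidicPatch.end₁, CyclidicPatch.end₂,
      hf, hgs] at hv h₂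
    exact (S.geographic_start (right_ne_zero_of_mul hu) f.proper₂ f.proper₁ k3 g.lt₂ k4 k1
      (g.lt₁.le.trans k2) hv fun t ht => h₂ ⟨t, ht, rfl⟩).symm
  opposite h := absurd trivial h

end FramedSphere

/-! ### Spheres with two parabolic pencils of circles -/

namespace FramedSphere

variable (S : FramedSphere)

/-- The polynomial expression for `cartesian`, which vanishes at `(π, π)`. -/
def affineCoordinates (α β : ℝ) : LieSpace :=
  ((1 + Real.cos α) * (1 + Real.cos β) / 2) • (S.w 3 - S.w 2)
    + (Real.sin α * (1 + Real.cos β)) • S.w 0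
    + ((1 + Real.cos α) * Real.sin β) • S.w 1
    + (1 - Real.cos α * Real.cos β) • (S.w 3 + S.w 2)

lemma cartesian_eq {α β : ℝ} (h : ¬ (Real.cos α = -1 ∧ Real.cos β = -1)) :
    S.cartesian α β = S.affineCoordinates α β := if_neg h

lemma cartesian_eq_infinity {α β : ℝ} (h : Real.cos α = -1 ∧ Real.cos β = -1) :
    S.cartesian α β = S.w 3 + S.w 2 := if_pos h

lemma form_s_cartesian (α β : ℝ) : form S.s (S.cartesian α β) = 0 := by
  by_cases h : Real.cos α = -1 ∧ Real.cos β = -1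
  · rw [S.cartesian_eq_infinity h]; simp [S.incident]
  · rw [S.cartesian_eq h]; simp [affineCoordinates, S.incident]

lemma form_affineCoordinates (α β α' β' : ℝ) :
    form (S.affineCoordinates α β) (S.affineCoordinates α' β') =
      Real.sin α * (1 + Real.cos β) * (Real.sin α' * (1 + Real.cos β')) +
      (1 + Real.cos α) * Real.sin β * ((1 + Real.cos α') * Real.sin β') -
      (1 + Real.cos α) * (1 + Real.cos β) * (1 - Real.cos α' * Real.cos β') -
      (1 - Real.cos α * Real.cos β) * ((1 + Real.cos α') * (1 + Real.cos β')) := by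
  simp [affineCoordinates, S.gram]
  ring

lemma form_affineCoordinates_infinity (α β : ℝ) :
    form (S.affineCoordinates α β) (S.w 3 + S.w 2) = -((1 + Real.cos α) * (1 + Real.cos β)) := by
  simp [affineCoordinates, S.gram]
  ring

lemma form_cartesian_self (α β : ℝ) : form (S.cartesian α β) (S.cartesian α β) = 0 := by
  by_cases h : Real.cos α = -1 ∧ Real.cos β = -1
  · rw [S.cartesian_eq_infinity h]; simp [S.gram]
  · rw [S.cartesian_eq h, form_affineCoordinates]
    linear_combination (1 + Real.cos β) ^ 2 * Real.sin_sq_add_cos_sq α +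
      (1 + Real.cos α) ^ 2 * Real.sin_sq_add_cos_sq β

lemma cartesian_eq_of_left {α : ℝ} (h : 1 + Real.cos α ≠ 0) (β : ℝ) :
    S.cartesian α β = S.affineCoordinates α β :=
  S.cartesian_eq fun h' => h (by rw [h'.1]; ring)

lemma cartesian_eq_of_right {β : ℝ} (h : 1 + Real.cos β ≠ 0) (α : ℝ) :
    S.cartesian α β = S.affineCoordinates α β :=
  S.cartesian_eq fun h' => h (by rw [h'.2]; ring)

/-- Division by `(1 + cos α)(1 + cos β)` gives the coordinates in `X = tan (α / 2)` and `Y = tan (β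
/ 2)`, where `X² + Y²` and the linear terms separate the variables. -/
lemma curvatureNet_cartesian : CurvatureNet (fun t u => contactVec S.s (S.cartesian t u))
    (fun t u => contactNormal S.s (S.cartesian t u))
    (fun t => S.s.er * (1 + Real.cos t)) (fun u => S.s.er * (1 + Real.cos u)) := by
  have hd : Differentiable ℝ fun t => 1 + Real.cos t := Real.differentiable_cos.const_add 1
  refine S.curvatureNet (c₁ := fun t => 1 + Real.cos t) (c₂ := fun t => 1 + Real.cos t)
    S.form_s_cartesian hd hd (fun u hu => ?_) (fun t ht => ?_) (fun t t' u u' ht ht' hu hu' => ?_)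
  · refine ⟨((1 + Real.cos u) / 2) • (S.w 3 - S.w 2) + Real.sin u • S.w 1
        - Real.cos u • (S.w 3 + S.w 2), (1 + Real.cos u) • S.w 0,
      ((1 + Real.cos u) / 2) • (S.w 3 - S.w 2) + Real.sin u • S.w 1 + (S.w 3 + S.w 2),
      ?_, ?_, fun t => ?_⟩
    · have h := Real.sin_sq_add_cos_sq u
      constructor <;> simp [S.gram]
      · linear_combination h
      · ring
      · linear_combination h
      · linear_combination h
    · simp [S.incident]
    · rw [S.cartesian_eq_of_right hu]; simp only [affineCoordinates, conic]; module
  · refine ⟨((1 + Real.cos t) / 2) • (S.w 3 - S.w 2) + Real.sin t • S.w 0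
        - Real.cos t • (S.w 3 + S.w 2), (1 + Real.cos t) • S.w 1,
      ((1 + Real.cos t) / 2) • (S.w 3 - S.w 2) + Real.sin t • S.w 0 + (S.w 3 + S.w 2),
      ?_, ?_, fun u => ?_⟩
    · have h := Real.sin_sq_add_cos_sq t
      constructor <;> simp [S.gram]
      · linear_combination h
      · ring
      · linear_combination h
      · linear_combination h
    · simp [S.incident]
    · rw [S.cartesian_eq_of_left ht]; simp only [affineCoordinates, conic]; module
  · simp only [S.cartesian_eq_of_left ht, S.cartesian_eq_of_left ht', affineCoordinates]; module

lemma toPoint_cartesian_of_cos_eq {α β : ℝ} (h : 1 + Real.cos α = 0 ∨ 1 + Real.cos β = 0) :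
    (contactVec S.s (S.cartesian α β)).toPoint = (contactVec S.s (S.w 3 + S.w 2)).toPoint := by
  by_cases hc : Real.cos α = -1 ∧ Real.cos β = -1
  · rw [S.cartesian_eq_infinity hc]
  have e : S.cartesian α β = (1 - Real.cos α * Real.cos β) • (S.w 3 + S.w 2) := by
    rw [S.cartesian_eq hc, affineCoordinates]
    have s {γ : ℝ} (hγ : 1 + Real.cos γ = 0) : Real.sin γ = 0 := by
      have := Real.sin_sq_add_cos_sq γ
      rw [show Real.cos γ = -1 by linarith] at this
      exact (pow_eq_zero_iff two_ne_zero).1 (by linarith)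
    rcases h with h | h <;> simp [h, s h]
  have hne : 1 - Real.cos α * Real.cos β ≠ 0 := by
    rcases h with h | h
    · have h1 : Real.cos α = -1 := by linarith
      rw [h1]
      exact fun h2 => hc ⟨h1, by linarith⟩
    · have h1 : Real.cos β = -1 := by linarith
      rw [h1]
      exact fun h2 => hc ⟨by linarith, h1⟩
  rw [e, ← toPoint_smul hne (contactVec S.s (S.w 3 + S.w 2))]
  congr 1
  simp only [contactVec, er_smul]; module

/-- The hypothesis `e` is `tan (α / 2) = tan (β / 2)` with denominators cleared. -/
lemma cos_sub_eq_one_of_half_angle {α β : ℝ} (h : 1 + Real.cos α ≠ 0) (h' : 1 + Real.cos β ≠ 0)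
    (e : Real.sin α * (1 + Real.cos β) = Real.sin β * (1 + Real.cos α)) :
    Real.cos (β - α) = 1 := by
  have h1 := Real.sin_sq_add_cos_sq α
  have h2 := Real.sin_sq_add_cos_sq β
  have e2 : (1 + Real.cos α) * (1 + Real.cos β) * (2 * (Real.cos β - Real.cos α)) = 0 := by
    have := congrArg (fun x => x ^ 2) e
    simp only [mul_pow] at this
    linear_combination this - (1 + Real.cos β) ^ 2 * h1 + (1 + Real.cos α) ^ 2 * h2
  have e3 : Real.cos β = Real.cos α := by
    have := (mul_eq_zero.1 e2).resolve_left (mul_ne_zero h h')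
    linarith
  rw [e3] at e
  have e4 := mul_right_cancel₀ h e
  rw [Real.cos_sub, e3, ← e4]
  linear_combination h1

lemma cos_sub_eq_one_of_cartesian_eq {α β α' β' : ℝ} (hα : 1 + Real.cos α ≠ 0)
    (hβ : 1 + Real.cos β ≠ 0)
    (e : (contactVec S.s (S.cartesian α β)).toPoint =
      (contactVec S.s (S.cartesian α' β')).toPoint) :
    Real.cos (α' - α) = 1 ∧ Real.cos (β' - β) = 1 := by
  have hne : 1 + Real.cos α' ≠ 0 ∧ 1 + Real.cos β' ≠ 0 := by
    rw [← not_or]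
    intro h
    rw [S.toPoint_cartesian_of_cos_eq h] at e
    have hf := S.form_eq_zero_of_toPoint_eq (S.form_s_cartesian _ _) (by simp [S.incident])
      (S.form_cartesian_self _ _) (by simp [S.gram]) e
    rw [S.cartesian_eq_of_left hα, form_affineCoordinates_infinity] at hf
    exact neg_ne_zero.2 (mul_ne_zero hα hβ) hf
  have hf := S.form_eq_zero_of_toPoint_eq (S.form_s_cartesian _ _) (S.form_s_cartesian _ _)
    (S.form_cartesian_self _ _) (S.form_cartesian_self _ _) e
  rw [S.cartesian_eq_of_left hα, S.cartesian_eq_of_left hne.1, form_affineCoordinates] at hf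
  have h1 := Real.sin_sq_add_cos_sq α
  have h2 := Real.sin_sq_add_cos_sq β
  have h1' := Real.sin_sq_add_cos_sq α'
  have h2' := Real.sin_sq_add_cos_sq β'
  -- This is `(X - X')² + (Y - Y')² = 0` in half-angle tangents, with denominators cleared.
  have key : ((1 + Real.cos β) * (1 + Real.cos β') *
        (Real.sin α * (1 + Real.cos α') - Real.sin α' * (1 + Real.cos α))) ^ 2 +
      ((1 + Real.cos α) * (1 + Real.cos α') *
        (Real.sin β * (1 + Real.cos β') - Real.sin β' * (1 + Real.cos β))) ^ 2 = 0 := by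
    linear_combination
      -2 * ((1 + Real.cos α) * (1 + Real.cos β) * (1 + Real.cos α') * (1 + Real.cos β')) * hf
      + ((1 + Real.cos α') * (1 + Real.cos β')) ^ 2 *
        ((1 + Real.cos β) ^ 2 * h1 + (1 + Real.cos α) ^ 2 * h2)
      + ((1 + Real.cos α) * (1 + Real.cos β)) ^ 2 *
        ((1 + Real.cos β') ^ 2 * h1' + (1 + Real.cos α') ^ 2 * h2')
  obtain ⟨k1, k2⟩ := (add_eq_zero_iff_of_nonneg (sq_nonneg _) (sq_nonneg _)).1 key
  rw [pow_eq_zero_iff two_ne_zero] at k1 k2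
  exact ⟨cos_sub_eq_one_of_half_angle hα hne.1
      (sub_eq_zero.1 ((mul_eq_zero.1 k1).resolve_left (mul_ne_zero hβ hne.2))),
    cos_sub_eq_one_of_half_angle hβ hne.2
      (sub_eq_zero.1 ((mul_eq_zero.1 k2).resolve_left (mul_ne_zero hα hne.1)))⟩

lemma isRegularNet_cartesian : (CyclidicSurface.cartesian S).IsRegularNet
    (fun t => S.s.er * (1 + Real.cos t)) (fun u => S.s.er * (1 + Real.cos u)) where
  net := S.curvatureNet_cartesian
  collapse₁ t ht u u' := by
    have h := (mul_eq_zero.1 ht).resolve_left S.not_point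
    exact (S.toPoint_cartesian_of_cos_eq (Or.inl h)).trans
      (S.toPoint_cartesian_of_cos_eq (Or.inl h)).symm
  collapse₂ u hu t t' := by
    have h := (mul_eq_zero.1 hu).resolve_left S.not_point
    exact (S.toPoint_cartesian_of_cos_eq (Or.inr h)).trans
      (S.toPoint_cartesian_of_cos_eq (Or.inr h)).symm
  start f g hf hg ht hu hv _ _ := by
    obtain ⟨k1, k2, k3, k4⟩ := CyclidicPatch.bounds_of_isSubpatch hg
    have hgs := hg.1.trans hf
    simp only [CyclidicPatch.vertex, CyclidicPatch.end₁, CyclidicPatch.end₂, hf, hgs] at hv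
    obtain ⟨e1, e2⟩ := S.cos_sub_eq_one_of_cartesian_eq (right_ne_zero_of_mul ht)
      (right_ne_zero_of_mul hu) hv.symm
    exact ⟨eq_of_cos_sub_eq_one k1 (by linarith [g.lt₁, f.proper₁]) e1,
      eq_of_cos_sub_eq_one k3 (by linarith [g.lt₂, f.proper₂]) e2⟩
  opposite h := absurd trivial h

end FramedSphere

lemma CyclidicSurface.exists_isRegularNet (C : CyclidicSurface) :
    ∃ ρ₁ ρ₂, C.IsRegularNet ρ₁ ρ₂ := by
  cases C with
  | dupin D => exact ⟨_, _, D.isRegularNet⟩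
  | geographic S => exact ⟨_, _, S.isRegularNet_geographic⟩
  | geographicSwap S => exact ⟨_, _, S.isRegularNet_geographicSwap⟩
  | cartesian S => exact ⟨_, _, S.isRegularNet_cartesian⟩

/-! ### Vertex frames along a side -/

namespace CurvatureNet

variable {h : ℝ → ℝ → LieSpace} {n : ℝ → ℝ → E3} {ρ₁ ρ₂ : ℝ → ℝ} {t t' u u' : ℝ}

lemma orthonormal (N : CurvatureNet h n ρ₁ ρ₂) (ht : ρ₁ t ≠ 0) (hu : ρ₂ u ≠ 0)
    (h0 : (h t u).e0 ≠ 0) {δ ε : ℝ} (hδ : |δ| = 1) (hε : |ε| = 1) :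
    Orthonormal ℝ ![δ • tangent₁ h t u, ε • tangent₂ h t u, n t u] := by
  have e1 := N.norm_tangent₁ hu h0
  have e2 : ‖tangent₂ h t u‖ = 1 := N.swap.norm_tangent₁ ht h0
  have e3 := N.norm_normal hu h0
  have i12 := N.inner_tangent₁_tangent₂ ht hu h0
  have i13 := N.inner_tangent₁_normal hu h0
  have i23 : ⟪tangent₂ h t u, n t u⟫_ℝ = 0 := N.swap.inner_tangent₁_normal ht h0
  have i21 := (real_inner_comm (tangent₁ h t u) (tangent₂ h t u)).trans i12
  have i31 := (real_inner_comm (tangent₁ h t u) (n t u)).trans i13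
  have i32 := (real_inner_comm (tangent₂ h t u) (n t u)).trans i23
  refine ⟨fun i => ?_, fun i j hij => ?_⟩
  · fin_cases i
    · simp [norm_smul, e1, hδ]
    · simp [norm_smul, e2, hε]
    · simp [e3]
  · fin_cases i <;> fin_cases j <;>
      simp [real_inner_smul_left, real_inner_smul_right, i12, i13, i23, i21, i31, i32] at hij ⊢

/-- The sign `ε` orients the transversal tangents towards the neighbouring vertices; its two values
serve the two opposite sides of a patch. -/
lemma framesRelated₁ (N : CurvatureNet h n ρ₁ ρ₂) (R : IsRegularRectangle h ρ₁ ρ₂ t t' u u')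
    (ε : ℝ) :
    FramesRelated 1 (h t u).affinePoint (h t' u).affinePoint (h t u').affinePoint
      (h t' u').affinePoint ![(1 : ℝ) • tangent₁ h t u, ε • tangent₂ h t u, n t u]
      ![(-1 : ℝ) • tangent₁ h t' u, ε • tangent₂ h t' u, n t' u] := by
  have e1 := N.bisectorReflection_tangent₁ R.ρu R.e0 R.e0₁ R.ne₁
  have e2 := N.bisectorReflection_tangent₂ R
  have e3 := N.bisectorReflection_normal R.ρu R.e0 R.e0₁ R.ne₁
  constructor <;> intro hs m
  · rw [if_neg hs] at e2
    fin_cases m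
    · simp [e1]
    · simp [bisectorReflection_smul, e2]
    · simp [e3]
  · rw [if_pos hs] at e2
    fin_cases m
    · simp [e1]
    · simp [bisectorReflection_smul, bisectorReflection_neg, e2]
    · simp [e3]

lemma framesRelated₂ (N : CurvatureNet h n ρ₁ ρ₂) (R : IsRegularRectangle h ρ₁ ρ₂ t t' u u')
    (ε : ℝ) :
    FramesRelated 0 (h t u).affinePoint (h t u').affinePoint (h t' u).affinePoint
      (h t' u').affinePoint ![ε • tangent₁ h t u, (1 : ℝ) • tangent₂ h t u, n t u]
      ![ε • tangent₁ h t u', (-1 : ℝ) • tangent₂ h t u', n t u'] := by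
  have e := N.swap.framesRelated₁ R.swap ε
  constructor <;> intro hs m
  · have e1 := e.1 hs
    fin_cases m
    · exact e1 1
    · exact e1 0
    · exact e1 2
  · have e1 := e.2 hs
    fin_cases m
    · exact e1 1
    · exact e1 0
    · exact e1 2

end CurvatureNet

/-! ### Subpatches and their vertices -/

namespace CyclidicPatch

lemma exists_unique_subpatch {f : CyclidicPatch} {ρ₁ ρ₂ : ℝ → ℝ}
    (R : f.surface.IsRegularNet ρ₁ ρ₂) {p₁ p₂ : OnePoint E3} (hp₁ : p₁ ∈ f.arc₁)
    (hp₂ : p₂ ∈ f.arc₂) (hx₁ : p₁ ≠ f.vertex false false) (hx₂ : p₂ ≠ f.vertex false false) :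
    ∃! g : CyclidicPatch, g.IsSubpatchWithVertices f p₁ p₂ := by
  obtain ⟨s₁, hs₁, rfl⟩ := hp₁
  obtain ⟨s₂, hs₂, rfl⟩ := hp₂
  -- A point different from `x` on each arc shows that neither line through `x` collapses.
  have hρ₂ : ρ₂ f.a₂ ≠ 0 := fun h => hx₁ (R.collapse₂ _ h _ _)
  have hρ₁ : ρ₁ f.a₁ ≠ 0 := fun h => hx₂ (R.collapse₁ _ h _ _)
  have l₁ : f.a₁ < s₁ := by
    refine lt_of_le_of_ne hs₁.1 ?_
    rintro rfl
    exact hx₁ rfl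
  have l₂ : f.a₂ < s₂ := by
    refine lt_of_le_of_ne hs₂.1 ?_
    rintro rfl
    exact hx₂ rfl
  have uniq {a b s t : ℝ} (hb : b < a + 2 * Real.pi) (hs : s ∈ Set.Icc a b)
      (ht : t ∈ Set.Icc a b) (h : Real.cos (t - s) = 1) : t = s := by
    have := (Real.cos_eq_one_iff_of_lt_of_lt (by linarith [hs.2, ht.1]) (by
      linarith [hs.1, ht.2])).1 h
    linarith
  refine ⟨⟨f.surface, f.a₁, s₁, f.a₂, s₂, l₁, l₂, by linarith [f.proper₁, hs₁.2],
    by linarith [f.proper₂, hs₂.2]⟩, ⟨⟨rfl, ?_, ?_⟩, rfl, ?_, ?_, rfl, rfl⟩, ?_⟩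
  · exact Set.Icc_subset_Icc_right hs₁.2
  · exact Set.Icc_subset_Icc_right hs₂.2
  · exact Set.image_mono (Set.Icc_subset_Icc_right hs₁.2)
  · exact Set.image_mono (Set.Icc_subset_Icc_right hs₂.2)
  · rintro g ⟨hg, hv, h₁, h₂, hg₁, hg₂⟩
    -- Once the initial parameters agree, injectivity of the two lines through `x` on less than a
    -- period fixes the end parameters.
    obtain ⟨e₁, e₂⟩ := R.start f g rfl hg hρ₁ hρ₂ hv h₁ h₂
    obtain ⟨-, k₁, -, k₂⟩ := bounds_of_isSubpatch hg
    have hgs := hg.1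
    obtain ⟨C, a₁, b₁, a₂, b₂, lt₁, lt₂, pr₁, pr₂⟩ := g
    dsimp only at hgs e₁ e₂ k₁ k₂
    subst hgs e₁ e₂
    have c₁ : b₁ = s₁ := uniq f.proper₁ hs₁ ⟨lt₁.le, k₁⟩ (R.net.cos_sub_eq_one hρ₂ hg₁.symm)
    have c₂ : b₂ = s₂ := uniq f.proper₂ hs₂ ⟨lt₂.le, k₂⟩
      ((R.net.swap.toPoint_line_eq_iff hρ₁).1 hg₂.symm)
    subst c₁ c₂
    rfl

/-- Adjacent vertices differ because coordinate lines are injective on less than a period. The two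
diagonals degenerate only together, so it suffices to separate the neighbours of `x`: by injectivity
on a Dupin cyclide, by assumption on a sphere. -/
lemma nodup_vertices {g : CyclidicPatch} {ρ₁ ρ₂ : ℝ → ℝ} (R : g.surface.IsRegularNet ρ₁ ρ₂)
    (ha₁ : ρ₁ g.a₁ ≠ 0) (hb₁ : ρ₁ g.b₁ ≠ 0) (ha₂ : ρ₂ g.a₂ ≠ 0) (hb₂ : ρ₂ g.b₂ ≠ 0)
    (hne : g.surface.IsSpherical → g.vertex true false ≠ g.vertex false true) :
    [g.vertex false false, g.vertex true false, g.vertex true true,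
      g.vertex false true].Nodup := by
  have c₁ : Real.cos (g.b₁ - g.a₁) ≠ 1 := by
    intro h
    linarith [g.lt₁, eq_of_cos_sub_eq_one g.lt₁.le g.proper₁ h]
  have c₂ : Real.cos (g.b₂ - g.a₂) ≠ 1 := by
    intro h
    linarith [g.lt₂, eq_of_cos_sub_eq_one g.lt₂.le g.proper₂ h]
  have h1 : g.vertex true false ≠ g.vertex false true := by
    by_cases hs : g.surface.IsSpherical
    · exact hne hs
    · exact fun h => c₁ (R.opposite hs g.a₁ g.b₁ g.a₂ g.b₂ ha₁ hb₁ ha₂ hb₂ h)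
  have h2 : g.vertex false false ≠ g.vertex true true :=
    fun h => h1 ((R.net.toPoint_diagonal_eq_iff ha₁ hb₁ ha₂ hb₂).1 h)
  have h3 : g.vertex false false ≠ g.vertex true false :=
    fun h => c₁ ((R.net.toPoint_line_eq_iff ha₂).1 h)
  have h4 : g.vertex false true ≠ g.vertex true true :=
    fun h => c₁ ((R.net.toPoint_line_eq_iff hb₂).1 h)
  have h5 : g.vertex false false ≠ g.vertex false true :=
    fun h => c₂ ((R.net.swap.toPoint_line_eq_iff ha₁).1 h)
  have h6 : g.vertex true false ≠ g.vertex true true :=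
    fun h => c₂ ((R.net.swap.toPoint_line_eq_iff hb₁).1 h)
  simp [h1, h2, h3, h4.symm, h5, h6]

lemma isRegularRectangle {g : CyclidicPatch} {ρ₁ ρ₂ : ℝ → ℝ} (ha₁ : ρ₁ g.a₁ ≠ 0)
    (hb₁ : ρ₁ g.b₁ ≠ 0) (ha₂ : ρ₂ g.a₂ ≠ 0) (hb₂ : ρ₂ g.b₂ ≠ 0)
    (hne : [g.vertex false false, g.vertex true false, g.vertex true true,
      g.vertex false true].Nodup) {x x₁ x₁₂ x₂ : E3} (hx : g.vertex false false = x)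
    (hx₁ : g.vertex true false = x₁) (hx₁₂ : g.vertex true true = x₁₂)
    (hx₂ : g.vertex false true = x₂) :
    CurvatureNet.IsRegularRectangle g.surface.hat ρ₁ ρ₂ g.a₁ g.b₁ g.a₂ g.b₂ := by
  have e := affinePoint_of_toPoint_eq hx
  have e₁ := affinePoint_of_toPoint_eq hx₁
  have e₁₂ := affinePoint_of_toPoint_eq hx₁₂
  have e₂ := affinePoint_of_toPoint_eq hx₂
  simp only [hx, hx₁, hx₁₂, hx₂, List.nodup_cons, List.mem_cons, List.not_mem_nil, or_false, not_or,
    not_false_eq_true, List.nodup_nil, and_true, OnePoint.coe_eq_coe] at hne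
  obtain ⟨⟨n1, n2, n3⟩, ⟨n4, n5⟩, n6⟩ := hne
  rw [← e, ← e₁] at n1
  rw [← e, ← e₁₂] at n2
  rw [← e, ← e₂] at n3
  rw [← e₁, ← e₁₂] at n4
  rw [← e₁, ← e₂] at n5
  rw [← e₁₂, ← e₂] at n6
  exact ⟨ha₁, hb₁, ha₂, hb₂, e0_ne_zero_of_toPoint_eq hx, e0_ne_zero_of_toPoint_eq hx₁,
    e0_ne_zero_of_toPoint_eq hx₂, e0_ne_zero_of_toPoint_eq hx₁₂, n1, n3, n2, Ne.symm n6, n4, n5⟩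

end CyclidicPatch

end

theorem mainTheorem11 (f : CyclidicPatch) (p₁ p₂ : OnePoint E3)
    (hp₁ : p₁ ∈ f.arc₁) (hp₂ : p₂ ∈ f.arc₂)
    (hx₁ : p₁ ≠ f.vertex false false) (hx₂ : p₂ ≠ f.vertex false false) :
    (∃! g : CyclidicPatch, g.IsSubpatchWithVertices f p₁ p₂) ∧
    (∀ g : CyclidicPatch, g.IsSubpatchWithVertices f p₁ p₂ →
      ¬ f.surface.IsSingular p₁ → ¬ f.surface.IsSingular p₂ →
      (f.surface.IsSpherical → p₁ ≠ p₂) →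
      [g.vertex false false, p₁, g.vertex true true, p₂].Nodup ∧
      Concircular {g.vertex false false, p₁, g.vertex true true, p₂} ∧
      ∀ x x₁ x₁₂ x₂ : E3, g.vertex false false = x → p₁ = x₁ →
        g.vertex true true = x₁₂ → p₂ = x₂ →
        (∀ i j, Orthonormal ℝ (g.vertexFrame i j)) ∧
        FramesRelated 1 x x₁ x₂ x₁₂ (g.vertexFrame false false) (g.vertexFrame true false) ∧
        FramesRelated 0 x x₂ x₁ x₁₂ (g.vertexFrame false false) (g.vertexFrame false true) ∧
        FramesRelated 0 x₁ x₁₂ x x₂ (g.vertexFrame true false) (g.vertexFrame true true) ∧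
        FramesRelated 1 x₂ x₁₂ x x₁ (g.vertexFrame false true) (g.vertexFrame true true)) := by
  obtain ⟨ρ₁, ρ₂, R⟩ := f.surface.exists_isRegularNet
  refine ⟨CyclidicPatch.exists_unique_subpatch R hp₁ hp₂ hx₁ hx₂, ?_⟩
  rintro g ⟨⟨hs, -, -⟩, -, -, -, rfl, rfl⟩ hn₁ hn₂ hne
  rw [← hs] at R hn₁ hn₂ hne
  -- Each of the four sides of the rectangle contains one of the two non-singular points, so none of
  -- the lines collapses.
  have ha₁ : ρ₁ g.a₁ ≠ 0 := fun h => hn₂ (Or.inl ⟨g.a₁, fun u => R.collapse₁ _ h _ _⟩)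
  have hb₁ : ρ₁ g.b₁ ≠ 0 := fun h => hn₁ (Or.inl ⟨g.b₁, fun u => R.collapse₁ _ h _ _⟩)
  have ha₂ : ρ₂ g.a₂ ≠ 0 := fun h => hn₁ (Or.inr ⟨g.a₂, fun u => R.collapse₂ _ h _ _⟩)
  have hb₂ : ρ₂ g.b₂ ≠ 0 := fun h => hn₂ (Or.inr ⟨g.b₂, fun u => R.collapse₂ _ h _ _⟩)
  have hnd := CyclidicPatch.nodup_vertices R ha₁ hb₁ ha₂ hb₂ hne
  refine ⟨hnd, R.net.concircular ha₁ hb₁ ha₂ hb₂ hnd, fun x x₁ x₁₂ x₂ h h₁ h₁₂ h₂ => ?_⟩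
  have Q := CyclidicPatch.isRegularRectangle ha₁ hb₁ ha₂ hb₂ hnd h h₁ h₁₂ h₂
  rw [← LieSpace.affinePoint_of_toPoint_eq h, ← LieSpace.affinePoint_of_toPoint_eq h₁,
    ← LieSpace.affinePoint_of_toPoint_eq h₁₂, ← LieSpace.affinePoint_of_toPoint_eq h₂]
  -- The sides at `x₁₂` are obtained by reversing the transversal parameter, which turns the sign of
  -- the transversal tangents into `-1`.
  refine ⟨fun i j => ?_, R.net.framesRelated₁ Q 1, R.net.framesRelated₂ Q 1,
    R.net.framesRelated₂ Q.reverse₁ (-1), R.net.framesRelated₁ Q.reverse₂ (-1)⟩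
  have abs_sign (i : Bool) : |(if i then -1 else 1 : ℝ)| = 1 := by cases i <;> simp
  have ht : ρ₁ (g.end₁ i) ≠ 0 := by cases i <;> assumption
  have hu : ρ₂ (g.end₂ j) ≠ 0 := by cases j <;> assumption
  have h0 : (g.surface.hat (g.end₁ i) (g.end₂ j)).e0 ≠ 0 := by
    cases i <;> cases j
    exacts [Q.e0, Q.e0₂, Q.e0₁, Q.e0₁₂]
  exact R.net.orthonormal ht hu h0 (abs_sign i) (abs_sign j)
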